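/- Let $d\ge 0$ be an even integer, let $S^e=\mathbb C[x_0,x_1,x_2]_e$ be the space of complex ternary forms of degree $e$, and for $r\ge 0$ let $$\sigma_r=\overline{\Big\{\textstyle\sum_{i=1}^r g_i^2 \;:\; g_1,\dots,g_r\in S^{d/2}\Big\}}\subseteq S^d$$ (Zariski closure) be the affine $r$-th secant variety $\sigma_r(\mathrm{Sq}_{d,2})$ of the variety $\mathrm{Sq}_{d,2}$ of squares. Let $r_g$ be the generic $2$-rank, that is, the smallest $r$ with $\sigma_r=S^d$. If $r<r_g$, then $\sigma_r$ is generically $\mathrm O(r)$-identifiable. That is, there is a Zariski open set $U\subseteq S^d$ with $\sigma_r\cap U$ Zariski dense in $\sigma_r$ such that every $f\in\sigma_r\cap U$ has $2$-rank exactly $r$ (it is a sum of $r$ squares of elements of $S^{d/2}$, and of no smaller number of such squares), and for any two decompositions $f=\sum_{i=1}^r g_i^2=\sum_{i=1}^r h_i^2$ with $g_i,h_i\in S^{d/2}$ there is a complex orthogonal matrix $A=(a_{ij})\in\mathrm O(r)$ (i.e. $AA^{\mathsf T}=I$) with $h_i=\sum_{j=1}^r a_{ij}g_j$ for all $i$.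 -/

import Mathlib

open MvPolynomial

namespace SumsOfSquares

/-- `Form n d` is the space `S^d ℂ^{n+1}` of complex forms of degree `d` in `x_0, …, x_n`. -/
abbrev Form (n d : ℕ) : Submodule ℂ (MvPolynomial (Fin (n + 1)) ℂ) :=
  homogeneousSubmodule (Fin (n + 1)) ℂ d

/-- The exponents of the monomials of degree `d` in `x_0, …, x_n`. -/
abbrev Exponent (n d : ℕ) : Type := {m : Fin (n + 1) →₀ ℕ // m.degree = d}

/-- The coordinates of a form of degree `d`: its coefficients at the monomials of degree `d`. -/
noncomputable def coords {n d : ℕ} (f : Form n d) : Exponent n d → ℂ :=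
  fun m => coeff m.1 f.1

/-- Zariski closed subsets of the affine space `S^d ℂ^{n+1}`: the common zero loci of sets of
polynomials in the coefficients. -/
def IsZariskiClosed {n d : ℕ} (Z : Set (Form n d)) : Prop :=
  ∃ P : Set (MvPolynomial (Exponent n d) ℂ), Z = {f | ∀ p ∈ P, eval (coords f) p = 0}

/-- The Zariski closure of `S` in `S^d ℂ^{n+1}`: the common zeros of all polynomials in the
coefficients that vanish on `S`. -/
def zariskiClosure {n d : ℕ} (S : Set (Form n d)) : Set (Form n d) :=
  {f | ∀ p : MvPolynomial (Exponent n d) ℂ,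
    (∀ g ∈ S, eval (coords g) p = 0) → eval (coords f) p = 0}

/-- A property holds for the general element of `X` if it holds at all points of `X ∩ U`, for some
Zariski open set `U` such that `X ∩ U` is Zariski dense in `X`. -/
def HoldsForGeneral {n d : ℕ} (X : Set (Form n d)) (p : Form n d → Prop) : Prop :=
  ∃ U : Set (Form n d), IsZariskiClosed Uᶜ ∧ X ⊆ zariskiClosure (X ∩ U) ∧ ∀ f ∈ X ∩ U, p f

/-- `SOS r f` is the set of all decompositions of `f` as a sum of `r` squares: the `r`-tuples of
forms of degree `d / 2` (for `d` even) whose squares add up to `f`. -/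
def SOS {n d : ℕ} (r : ℕ) (f : Form n d) : Set (Fin r → Form n (d / 2)) :=
  {g | f.1 = ∑ i, (g i).1 ^ 2}

/-- The forms that are sums of `r` squares (some of which may be zero). -/
def openSecant (n d r : ℕ) : Set (Form n d) := {f | (SOS r f).Nonempty}

/-- The affine `r`-secant variety `σ_r(Sq_{d,n})` of the variety of squares `Sq_{d,n}`. -/
def secant (n d r : ℕ) : Set (Form n d) := zariskiClosure (openSecant n d r)

/-- `f` has `2`-rank `r`: `r` is the smallest number of squares needed to write `f`. -/
def HasTwoRank {n d : ℕ} (f : Form n d) (r : ℕ) : Prop := IsLeast {s | f ∈ openSecant n d s} r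

/-- The generic `2`-rank: the smallest `r` such that `σ_r(Sq_{d,n})` is the whole space
`S^d ℂ^{n+1}`. -/
noncomputable def genericTwoRank (n d : ℕ) : ℕ := sInf {r | secant n d r = Set.univ}

/-- The action of an `r × r` matrix on `r`-tuples of forms. -/
noncomputable def act {n e r : ℕ} (A : Matrix (Fin r) (Fin r) ℂ) (g : Fin r → Form n e) :
    Fin r → Form n e :=
  fun i => ∑ j, A i j • g j

/-- `f` is `O(r)`-identifiable: `f` has `2`-rank `r`, and any two decompositions of `f` as a sum
of `r` squares lie in the same orbit of the complex orthogonal group `O(r)`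
(the matrices with `A * Aᵀ = 1`). -/
def IsOIdentifiable {n d : ℕ} (r : ℕ) (f : Form n d) : Prop :=
  HasTwoRank f r ∧
    ∀ g ∈ SOS r f, ∀ h ∈ SOS r f, ∃ A ∈ Matrix.orthogonalGroup (Fin r) ℂ, h = act A g

/-- `σ_r(Sq_{d,n})` is generically `O(r)`-identifiable. -/
def GenericallyOIdentifiable (n d r : ℕ) : Prop :=
  HoldsForGeneral (secant n d r) (IsOIdentifiable r)

end SumsOfSquares

/-! Write e = d/2. At a general point, the tangent space of the closure of the image of g ↦ ∑ g_i²
is the image of the differential, i.e. the degree d part of the ideal (g_1, …, g_r). It depends only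
on f = ∑ g_i², so for any other decomposition f = ∑ h_i² all products h_i · S^e lie in (g)
(`exists_forall_image_differential_le`). If this forces each h_i into the span of the g_j, then h =
A g, and ∑ h_i² = ∑ g_i² turns the symmetric matrix AᵀA - 1 into a relation among the g_i. If such
relations are Koszul, the matrix is also antisymmetric, so it vanishes and A is orthogonal
(`exists_orthogonal_of_koszulExact`).

Both conditions form `KoszulExact`. This is exactness of a complex of linear maps depending affinely
on g, hence open by semicontinuity of rank, so one example suffices. Chevalley's theorem ensures
that a general point of the secant variety is an actual sum of squares of a general tuple.

The example is x_0^e, …, x_{r-1}^e, which needs r ≤ 3. This is enough: the e-th powers of four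
linear forms generate all ternary forms of degree 2e (`mem_span_fourLinearForms_pow`), so the
differential is generically surjective and r_g ≤ 4. For r = 3 the socle degree 3e - 3 of the
complete intersection must be at least 2e, i.e. e ≥ 3; for e ≤ 2 the three powers already generate
degree 2e, so r_g ≤ 3. -/

namespace SumsOfSquares

/-! ### Extending derivations to a field in characteristic zero. -/

theorem exists_derivation_extension {k R K : Type*} [Field k] [CharZero k] [CommRing R] [IsDomain R]
    [Field K] [Algebra k R] [Algebra k K] [Algebra R K] [IsScalarTower k R K] [FaithfulSMul R K]
    [Algebra.EssFiniteType k K] (δ : Derivation k R K) :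
    ∃ D : Derivation k K K, ∀ a, D (algebraMap R K a) = δ a := by
  let F := FractionRing R
  let _ : Algebra F K := FractionRing.liftAlgebra R K
  have : IsScalarTower R F K := FractionRing.isScalarTower_liftAlgebra R K
  have : IsScalarTower k F K := .to₁₃₄ k R F K
  have : CharZero F := charZero_of_injective_algebraMap (algebraMap k F).injective
  have : Algebra.EssFiniteType F K := .of_comp k F K
  have : Algebra.FormallySmooth R F := .of_isLocalization (nonZeroDivisors R)
  have : Algebra.FormallySmooth R K := .comp R F K
  -- Formal smoothness of `K` over `R` kills `H1Cotangent`, the obstruction to injectivity. A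
  -- `K`-linear retraction of this map then extends the functional attached to `δ`.
  have hinj : Function.Injective (KaehlerDifferential.mapBaseChange k R K) := by
    rw [injective_iff_map_eq_zero]
    intro x hx
    obtain ⟨y, rfl⟩ := (Algebra.H1Cotangent.exact_δ_mapBaseChange k R K x).mp hx
    rw [Subsingleton.elim y 0, map_zero]
  obtain ⟨s, hs⟩ := LinearMap.exists_leftInverse_of_injective _ (LinearMap.ker_eq_bot.mpr hinj)
  let l : TensorProduct R K (KaehlerDifferential k R) →ₗ[K] K :=
    LinearMap.liftBaseChange K δ.liftKaehlerDifferential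
  refine ⟨(l ∘ₗ s).compDer (KaehlerDifferential.D k K), fun a => ?_⟩
  have h1 : KaehlerDifferential.D k K (algebraMap R K a) =
      KaehlerDifferential.mapBaseChange k R K (1 ⊗ₜ KaehlerDifferential.D k R a) := by
    simp
  have h2 := LinearMap.congr_fun hs (1 ⊗ₜ[R] KaehlerDifferential.D k R a)
  simp only [LinearMap.comp_apply, LinearMap.id_apply] at h2
  change l (s (KaehlerDifferential.D k K (algebraMap R K a))) = δ a
  rw [h1, h2]
  simp [l]

/-- A derivation along `ψ` that vanishes on `ker ψ` descends to the domain `ψ.range`, from which it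
extends to `K`. -/
theorem exists_derivation_of_algHom {k A K : Type*} [Field k] [CharZero k] [CommRing A]
    [Field K] [Algebra k A] [Algebra k K] [Algebra.EssFiniteType k K] (ψ : A →ₐ[k] K)
    (δ : A →ₗ[k] K) (hmul : ∀ a b, δ (a * b) = ψ a * δ b + ψ b * δ a)
    (hker : ∀ a, ψ a = 0 → δ a = 0) :
    ∃ D : Derivation k K K, ∀ a, D (ψ a) = δ a := by
  have key : ∀ a b, ψ a = ψ b → δ a = δ b := fun a b h =>
    sub_eq_zero.mp (by rw [← map_sub]; exact hker _ (by rw [map_sub, h, sub_self]))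
  choose lift hlift using fun x : ψ.range => x.2
  have hl : ∀ (x : ψ.range) (a : A), ψ a = x → δ (lift x) = δ a := fun x a h =>
    key _ _ ((hlift x).trans h.symm)
  let L : ψ.range →ₗ[k] K :=
    { toFun := fun x => δ (lift x)
      map_add' := fun x y => by
        rw [hl (x + y) (lift x + lift y) (by simpa using congrArg₂ (· + ·) (hlift x) (hlift y)),
          map_add]
      map_smul' := fun c x => by
        rw [hl (c • x) (c • lift x) (by simpa using congrArg (c • ·) (hlift x)), map_smul]; rfl }
  let d : Derivation k ψ.range K := Derivation.mk' L fun x y => by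
    have := hl (x * y) (lift x * lift y) (by simpa using congrArg₂ (· * ·) (hlift x) (hlift y))
    change δ (lift (x * y)) = (x : K) * δ (lift y) + (y : K) * δ (lift x)
    rw [this, hmul]
    exact congrArg₂ (fun u v => u * δ (lift y) + v * δ (lift x)) (hlift x) (hlift y)
  obtain ⟨D, hD⟩ := exists_derivation_extension d
  exact ⟨D, fun a => (hD ⟨ψ a, a, rfl⟩).trans (hl _ a rfl)⟩

/-! ### Rank and exactness for matrices of polynomials. -/

section Rank

variable {l m n : Type*} [Fintype l] [Fintype m] [Fintype n]

/-- A rank certificate that survives deformation: when `N` varies, `det (P * N * Q) ≠ 0` still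
bounds its rank from below. -/
theorem exists_mul_mul_eq_one_of_rank [DecidableEq m] [DecidableEq n] {K : Type*} [Field K]
    (N : Matrix m n K) :
    ∃ (P : Matrix (Fin N.rank) m K) (Q : Matrix n (Fin N.rank) K), P * N * Q = 1 := by
  let f := N.mulVecLin
  let b : Module.Basis (Fin N.rank) K (LinearMap.range f) :=
    Module.finBasisOfFinrankEq K _ rfl
  obtain ⟨s, hs⟩ := f.rangeRestrict.exists_rightInverse_of_surjective f.range_rangeRestrict
  obtain ⟨p, hp⟩ := (LinearMap.range f).subtype.exists_leftInverse_of_injective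
    (Submodule.ker_subtype _)
  refine ⟨LinearMap.toMatrix' (b.equivFun.toLinearMap ∘ₗ p),
    LinearMap.toMatrix' (s ∘ₗ b.equivFun.symm.toLinearMap), ?_⟩
  have hN : LinearMap.toMatrix' f = N := LinearMap.toMatrix'_toLin' N
  suffices h : LinearMap.toMatrix' (b.equivFun.toLinearMap ∘ₗ p) * LinearMap.toMatrix' f *
      LinearMap.toMatrix' (s ∘ₗ b.equivFun.symm.toLinearMap) = 1 by rwa [hN] at h
  rw [← LinearMap.toMatrix'_comp, ← LinearMap.toMatrix'_comp, ← LinearMap.toMatrix'_id]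
  congr 1
  refine LinearMap.ext fun v => ?_
  have h1 := LinearMap.congr_fun hs (b.equivFun.symm v)
  have h2 : f (s (b.equivFun.symm v)) = b.equivFun.symm v := congrArg Subtype.val h1
  have h3 := LinearMap.congr_fun hp (b.equivFun.symm v)
  simp only [LinearMap.comp_apply, Submodule.subtype_apply, LinearMap.id_apply] at h3
  change b.equivFun (p (f (s (b.equivFun.symm v)))) = v
  rw [h2, h3, LinearEquiv.apply_symm_apply]

theorem le_rank_of_isUnit_det_mul_mul {K : Type*} [Field K] {r : ℕ} (N : Matrix m n K)
    (P : Matrix (Fin r) m K) (Q : Matrix n (Fin r) K) (h : IsUnit (P * N * Q).det) :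
    r ≤ N.rank := by
  have h1 : (P * N * Q).rank = r := by
    rw [Matrix.rank_of_isUnit _ ((Matrix.isUnit_iff_isUnit_det _).mpr h), Fintype.card_fin]
  rw [← h1]
  exact (Matrix.rank_mul_le_left _ _).trans (Matrix.rank_mul_le_right _ _)

variable {k σ : Type*} [Field k]

theorem exists_rank_eval_ge_of_point [DecidableEq m] [DecidableEq n]
    (N : Matrix m n (MvPolynomial σ k)) (γ₀ : σ → k) :
    ∃ q : MvPolynomial σ k, q ≠ 0 ∧
      ∀ γ, eval γ q ≠ 0 → (N.map (eval γ₀)).rank ≤ (N.map (eval γ)).rank := by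
  obtain ⟨P, Q, h⟩ := exists_mul_mul_eq_one_of_rank (N.map (eval γ₀))
  let P' : Matrix _ m (MvPolynomial σ k) := P.map (C : k →+* MvPolynomial σ k)
  let Q' : Matrix n _ (MvPolynomial σ k) := Q.map (C : k →+* MvPolynomial σ k)
  have hev : ∀ γ, eval γ (P' * N * Q').det = (P * N.map (eval γ) * Q).det := fun γ => by
    have hP : P'.map (eval γ) = P := by ext; simp [P']
    have hQ : Q'.map (eval γ) = Q := by ext; simp [Q']
    rw [RingHom.map_det, RingHom.mapMatrix_apply, Matrix.map_mul, Matrix.map_mul, hP, hQ]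
  refine ⟨(P' * N * Q').det, fun h0 => ?_,
    fun γ hγ => ?_⟩
  · have := hev γ₀
    rw [h0, h, map_zero, Matrix.det_one] at this
    exact zero_ne_one this
  · rw [hev] at hγ
    exact le_rank_of_isUnit_det_mul_mul _ P Q (isUnit_iff_ne_zero.mpr hγ)

theorem exists_map_eq_smul {R K : Type*} [CommRing R] [IsDomain R] [Field K] [Algebra R K]
    [IsFractionRing R K] (P : Matrix m n K) :
    ∃ (c : R) (P' : Matrix m n R), c ≠ 0 ∧ P'.map (algebraMap R K) = algebraMap R K c • P := by
  obtain ⟨c, hc⟩ := IsLocalization.exist_integer_multiples_of_finite (nonZeroDivisors R)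
    (fun ij : m × n => P ij.1 ij.2)
  choose P' hP' using hc
  refine ⟨c, Matrix.of fun i j => P' (i, j), nonZeroDivisors.ne_zero c.2, ?_⟩
  ext i j
  simpa [Algebra.smul_def] using hP' (i, j)

/-- Clearing denominators in a rank certificate over the fraction field gives `P' * N * Q' = (c * d)
• 1` over polynomials, which specialises wherever `c * d` does not vanish. -/
theorem exists_rank_eval_ge_of_fractionRing [DecidableEq m] [DecidableEq n]
    (N : Matrix m n (MvPolynomial σ k)) :
    ∃ q : MvPolynomial σ k, q ≠ 0 ∧ ∀ γ, eval γ q ≠ 0 →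
      (N.map (algebraMap _ (FractionRing (MvPolynomial σ k)))).rank ≤ (N.map (eval γ)).rank := by
  obtain ⟨P, Q, h⟩ := exists_mul_mul_eq_one_of_rank
    (N.map (algebraMap _ (FractionRing (MvPolynomial σ k))))
  obtain ⟨c, P', hc, hP⟩ := exists_map_eq_smul (R := MvPolynomial σ k) P
  obtain ⟨d, Q', hd, hQ⟩ := exists_map_eq_smul (R := MvPolynomial σ k) Q
  have hPQ : P' * N * Q' = (c * d) • (1 : Matrix _ _ (MvPolynomial σ k)) := by
    have hinj := IsFractionRing.injective (MvPolynomial σ k) (FractionRing (MvPolynomial σ k))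
    refine Matrix.map_injective hinj ?_
    change (P' * N * Q').map _ = Matrix.map _ _
    rw [Matrix.map_mul, Matrix.map_mul, hP, hQ, Matrix.smul_mul, Matrix.smul_mul,
      Matrix.mul_smul, h, smul_smul, ← map_mul]
    ext i j
    by_cases hij : i = j <;> simp [hij]
  refine ⟨c * d, mul_ne_zero hc hd, fun γ hγ => ?_⟩
  refine le_rank_of_isUnit_det_mul_mul _ (P'.map (eval γ)) (Q'.map (eval γ)) ?_
  rw [← Matrix.map_mul, ← Matrix.map_mul, hPQ, ← RingHom.mapMatrix_apply, ← RingHom.map_det,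
    Matrix.det_smul, Matrix.det_one, mul_one, map_pow, isUnit_iff_ne_zero]
  exact pow_ne_zero _ hγ

omit [Fintype l] in
-- By rank-nullity, exactness of a complex is a lower bound on the sum of the two ranks; such bounds
-- are open conditions.
theorem exact_of_card_le_rank_add_rank {K : Type*} [Field K] (N : Matrix l m K)
    (J : Matrix m n K) (h0 : N * J = 0) (h : Fintype.card m ≤ N.rank + J.rank) (v : m → K)
    (hv : N.mulVec v = 0) : ∃ u, v = J.mulVec u := by
  have hle : LinearMap.range J.mulVecLin ≤ LinearMap.ker N.mulVecLin := by
    rintro _ ⟨u, rfl⟩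
    simp [h0]
  have hrn := LinearMap.finrank_range_add_finrank_ker N.mulVecLin
  rw [Module.finrank_fintype_fun_eq_card] at hrn
  have heq := Submodule.eq_of_le_of_finrank_le hle (by
    change N.rank + _ = _ at hrn
    change _ ≤ J.rank
    omega)
  obtain ⟨u, hu⟩ := heq.ge (show v ∈ LinearMap.ker N.mulVecLin from hv)
  exact ⟨u, hu.symm⟩

omit [Fintype l] in
theorem card_le_rank_add_rank_of_exact {K : Type*} [Field K] (N : Matrix l m K)
    (J : Matrix m n K) (h : ∀ v, N.mulVec v = 0 → ∃ u, v = J.mulVec u) :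
    Fintype.card m ≤ N.rank + J.rank := by
  have hle : LinearMap.ker N.mulVecLin ≤ LinearMap.range J.mulVecLin := fun v hv => by
    obtain ⟨u, hu⟩ := h v hv
    exact ⟨u, hu.symm⟩
  have hrn := LinearMap.finrank_range_add_finrank_ker N.mulVecLin
  rw [Module.finrank_fintype_fun_eq_card] at hrn
  have := Submodule.finrank_mono hle
  change N.rank + _ = _ at hrn
  change _ ≤ J.rank at this
  omega

/-- Exactness of a complex of polynomial matrices at a point is an open condition. -/
theorem exists_forall_exact_of_point (N : Matrix l m (MvPolynomial σ k))
    (J : Matrix m n (MvPolynomial σ k)) (h0 : N * J = 0) (γ₀ : σ → k)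
    (h : ∀ v, (N.map (eval γ₀)).mulVec v = 0 → ∃ u, v = (J.map (eval γ₀)).mulVec u) :
    ∃ q : MvPolynomial σ k, q ≠ 0 ∧ ∀ γ, eval γ q ≠ 0 →
      ∀ v, (N.map (eval γ)).mulVec v = 0 → ∃ u, v = (J.map (eval γ)).mulVec u := by
  classical
  obtain ⟨q₁, hq₁, h₁⟩ := exists_rank_eval_ge_of_point N γ₀
  obtain ⟨q₂, hq₂, h₂⟩ := exists_rank_eval_ge_of_point J γ₀
  refine ⟨q₁ * q₂, mul_ne_zero hq₁ hq₂, fun γ hγ => ?_⟩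
  rw [map_mul, mul_ne_zero_iff] at hγ
  refine exact_of_card_le_rank_add_rank _ _ ?_ ((card_le_rank_add_rank_of_exact _ _ h).trans
    (add_le_add (h₁ γ hγ.1) (h₂ γ hγ.2)))
  rw [← Matrix.map_mul, h0]
  ext; simp

/-- A complex of polynomial matrices that is exact over the fraction field is exact at the
general point. -/
theorem exists_forall_exact_of_fractionRing (N : Matrix l m (MvPolynomial σ k))
    (J : Matrix m n (MvPolynomial σ k)) (h0 : N * J = 0)
    (h : ∀ v, (N.map (algebraMap _ (FractionRing (MvPolynomial σ k)))).mulVec v = 0 →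
      ∃ u, v = (J.map (algebraMap _ (FractionRing (MvPolynomial σ k)))).mulVec u) :
    ∃ q : MvPolynomial σ k, q ≠ 0 ∧ ∀ γ, eval γ q ≠ 0 →
      ∀ v, (N.map (eval γ)).mulVec v = 0 → ∃ u, v = (J.map (eval γ)).mulVec u := by
  classical
  obtain ⟨q₁, hq₁, h₁⟩ := exists_rank_eval_ge_of_fractionRing N
  obtain ⟨q₂, hq₂, h₂⟩ := exists_rank_eval_ge_of_fractionRing J
  refine ⟨q₁ * q₂, mul_ne_zero hq₁ hq₂, fun γ hγ => ?_⟩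
  rw [map_mul, mul_ne_zero_iff] at hγ
  refine exact_of_card_le_rank_add_rank _ _ ?_ ((card_le_rank_add_rank_of_exact _ _ h).trans
    (add_le_add (h₁ γ hγ.1) (h₂ γ hγ.2)))
  rw [← Matrix.map_mul, h0]
  ext; simp

end Rank

/-! ### Images of morphisms of affine spaces (Chevalley). -/

theorem exists_eval_eq_of_notMem_isPrime {k σ : Type*} [Field k] [IsAlgClosed k] [Finite σ]
    (P : Ideal (MvPolynomial σ k)) [P.IsPrime] (q : MvPolynomial σ k) (hq : q ∉ P) :
    ∃ γ : σ → k, (∀ p ∈ P, eval γ p = 0) ∧ eval γ q ≠ 0 := by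
  by_contra! h
  refine hq ?_
  rw [← IsPrime.vanishingIdeal_zeroLocus (K := k) P]
  exact fun γ hγ => h γ fun p hp => hγ p hp

/-- The image of a nonempty basic open set under a morphism of affine spaces contains a nonempty
basic open subset of the closure of the image. -/
theorem exists_eval_eq_of_mem_basicOpen {k σ τ : Type*} [Field k] [IsAlgClosed k] [Finite σ]
    [Finite τ] (φ : τ → MvPolynomial σ k) (q : MvPolynomial σ k) (hq : q ≠ 0) :
    ∃ p : MvPolynomial τ k, aeval φ p ≠ 0 ∧
      ∀ y : τ → k, (∀ s : MvPolynomial τ k, aeval φ s = 0 → eval y s = 0) → eval y p ≠ 0 →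
        ∃ γ : σ → k, eval γ q ≠ 0 ∧ ∀ j, y j = eval γ (φ j) := by
  let f : MvPolynomial τ k →+* MvPolynomial σ k := (aeval φ).toRingHom
  have hf : f.FinitePresentation := by
    refine RingHom.FinitePresentation.of_finiteType.mp ?_
    refine RingHom.FiniteType.of_comp_finiteType (f := C) ?_
    have : f.comp C = algebraMap k (MvPolynomial σ k) := by ext; simp [f]
    rw [this, RingHom.finiteType_algebraMap]
    infer_instance
  obtain ⟨S, hS⟩ := PrimeSpectrum.exists_constructibleSetData_iff.mpr
    (PrimeSpectrum.isConstructible_comap_image hf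
      (PrimeSpectrum.isConstructible_basicOpen (f := q)))
  -- The generic point of the source lies in D(q), so the generic point of the image closure lies in
  -- one locally closed piece of the image. That piece is open in the closure, and its `D.f` is the
  -- wanted polynomial.
  have hbot : PrimeSpectrum.comap f ⊥ ∈ S.toSet := by
    rw [hS]
    exact ⟨⊥, by simpa using hq, rfl⟩
  simp only [PrimeSpectrum.ConstructibleSetData.toSet, Set.mem_iUnion] at hbot
  obtain ⟨D, hD, hg, hf'⟩ := hbot
  refine ⟨D.f, fun h => hf' ?_, fun y hy hyp => ?_⟩
  · simpa [f] using h
  let m : Ideal (MvPolynomial τ k) := RingHom.ker (eval y)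
  have hm : m.IsMaximal := RingHom.ker_isMaximal_of_surjective _ fun c => ⟨C c, by simp⟩
  have hmem : (⟨m, hm.isPrime⟩ : PrimeSpectrum _) ∈ S.toSet := by
    simp only [PrimeSpectrum.ConstructibleSetData.toSet, Set.mem_iUnion]
    refine ⟨D, hD, ?_, ?_⟩
    · rintro _ ⟨i, rfl⟩
      exact hy _ (by simpa [f] using hg ⟨i, rfl⟩)
    · simpa [m] using hyp
  rw [hS] at hmem
  obtain ⟨P, hqP, hP⟩ := hmem
  -- The point `y` is hit by a prime `P` that need not be maximal; the Nullstellensatz gives a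
  -- closed point of V(P) off V(q), which also lies over `y`.
  obtain ⟨γ, hγ, hγq⟩ := exists_eval_eq_of_notMem_isPrime P.asIdeal q hqP
  refine ⟨γ, hγq, fun j => ?_⟩
  have h1 : (X j - C (y j) : MvPolynomial τ k) ∈ m := by simp [m]
  have h2 : m = P.asIdeal.comap f := (congrArg PrimeSpectrum.asIdeal hP).symm
  rw [h2, Ideal.mem_comap] at h1
  have h3 := hγ _ h1
  simp only [f, AlgHom.toRingHom_eq_coe, RingHom.coe_coe, map_sub, aeval_X, algHom_C,
    algebraMap_eq, eval_C] at h3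
  exact (sub_eq_zero.mp h3).symm

/-! ### Tangent spaces of image closures and dominance. -/

section Tangent

variable {k σ τ : Type*} [Field k]

theorem aeval_pderiv_chain [Fintype τ] {R : Type*} [CommRing R] [Algebra k R]
    (ψ : τ → R) (D : Derivation k R R) (p : MvPolynomial τ k) :
    D (aeval ψ p) = ∑ j, aeval ψ (pderiv j p) * D (ψ j) := by
  classical
  induction p using MvPolynomial.induction_on with
  | C a => simp
  | add p q hp hq => simp [hp, hq, add_mul, Finset.sum_add_distrib]
  | mul_X p i hp =>
    simp only [map_mul, aeval_X, Derivation.leibniz, hp, smul_eq_mul, map_add, add_mul,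
      Finset.sum_add_distrib, pderiv_X, Finset.mul_sum]
    congr 1
    · simp [Pi.single_apply, apply_ite]
    · exact Finset.sum_congr rfl fun j _ => by ring

theorem eval_aeval (φ : τ → MvPolynomial σ k) (γ : σ → k) (p : MvPolynomial τ k) :
    eval γ (aeval φ p) = eval (fun j => eval γ (φ j)) p := by
  induction p using MvPolynomial.induction_on with
  | C a => simp
  | add p q hp hq => simp only [map_add, hp, hq]
  | mul_X p i hp => simp only [map_mul, hp, aeval_X, eval_X]

/-- At the general point, the Zariski tangent space of the closure of the image of a morphism of
affine spaces is the image of the differential. -/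
theorem exists_forall_tangent_eq_image [CharZero k] [Fintype σ] [Fintype τ]
    (φ : τ → MvPolynomial σ k) :
    ∃ q : MvPolynomial σ k, q ≠ 0 ∧ ∀ γ, eval γ q ≠ 0 → ∀ v : τ → k,
      (∀ p : MvPolynomial τ k, aeval φ p = 0 →
        ∑ j, eval (fun j => eval γ (φ j)) (pderiv j p) * v j = 0) →
      ∃ u : σ → k, ∀ j, v j = ∑ i, eval γ (pderiv i (φ j)) * u i := by
  classical
  let B := MvPolynomial σ k
  let K := FractionRing B
  let row : MvPolynomial τ k → τ → K := fun p j => algebraMap B K (aeval φ (pderiv j p))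
  -- Finitely many relations suffice: their gradients span the conormal space over the function
  -- field.
  obtain ⟨s, hsub, hspan⟩ := (Submodule.fg_span_iff_fg_span_finset_subset
    (row '' {p | aeval φ p = 0})).mp (IsNoetherian.noetherian (R := K) _)
  choose p hp hrow using fun w : s => hsub w.2
  let N : Matrix s τ B := Matrix.of fun w j => aeval φ (pderiv j (p w))
  let J : Matrix τ σ B := Matrix.of fun j i => pderiv i (φ j)
  have hNJ : N * J = 0 := by
    ext1 w i
    have h := aeval_pderiv_chain φ (pderiv i) (p w)
    rw [show aeval φ (p w) = 0 from hp w, map_zero] at h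
    exact h.symm
  have hK : ∀ v, (N.map (algebraMap B K)).mulVec v = 0 →
      ∃ u, v = (J.map (algebraMap B K)).mulVec u := by
    intro v hv
    have hv' : ∀ p, aeval φ p = 0 → ∑ j, row p j * v j = 0 := by
      intro p₀ hp₀
      have hmem : row p₀ ∈ Submodule.span K (s : Set (τ → K)) :=
        hspan ▸ Submodule.subset_span ⟨p₀, hp₀, rfl⟩
      generalize row p₀ = w at hmem
      induction hmem using Submodule.span_induction with
      | mem w hw =>
        have := congrFun hv ⟨w, hw⟩
        rw [← show row _ = w from hrow ⟨w, hw⟩]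
        exact this
      | zero => simp
      | add x y _ _ hx hy => simp [add_mul, Finset.sum_add_distrib, hx, hy]
      | smul c x _ hx => simp [mul_assoc, ← Finset.mul_sum, hx]
    -- A vector killed by all gradients defines a derivation on the coordinate ring of the image
    -- closure. Its extension to `K` is determined by its values on the variables, and the chain
    -- rule makes these the preimage of `v` under the Jacobian.
    let ψ : MvPolynomial τ k →ₐ[k] K := (Algebra.algHom k B K).comp (aeval φ)
    obtain ⟨D, hD⟩ := exists_derivation_of_algHom ψ
      (∑ j, LinearMap.mulRight k (v j) ∘ₗ ψ.toLinearMap ∘ₗ (pderiv j).toLinearMap)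
      (fun a b => by
        simp only [LinearMap.coe_sum, Finset.sum_apply, LinearMap.comp_apply,
          LinearMap.mulRight_apply, AlgHom.toLinearMap_apply, Derivation.coeFn_coe,
          Derivation.leibniz, smul_eq_mul, map_add, map_mul, Finset.sum_add_distrib,
          Finset.mul_sum, mul_assoc])
      (fun a ha => by
        have : aeval φ a = 0 := IsFractionRing.injective B K (ha.trans (map_zero _).symm)
        rw [LinearMap.coe_sum, Finset.sum_apply]
        exact hv' a this)
    refine ⟨fun i => D (algebraMap B K (X i)), funext fun j => ?_⟩
    have h1 := hD (X j)
    have h2 := aeval_pderiv_chain (fun i => algebraMap B K (X i)) D (φ j)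
    have h3 : ∀ b : B, aeval (fun i => algebraMap B K (X i)) b = algebraMap B K b := fun b => by
      have : aeval (R := k) (fun i => algebraMap B K (X i)) = Algebra.algHom k B K := by
        ext i
        rw [aeval_X]; rfl
      rw [this]; rfl
    simp only [h3] at h2
    have h4 : ψ (X j) = algebraMap B K (φ j) := congrArg (algebraMap B K) (aeval_X φ j)
    rw [h4, h2] at h1
    simpa [pderiv_X, Pi.single_apply, apply_ite, J, Matrix.mulVec, dotProduct] using h1.symm
  obtain ⟨q, hq, h⟩ := exists_forall_exact_of_fractionRing N J hNJ hK
  refine ⟨q, hq, fun γ hγ v hv => ?_⟩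
  obtain ⟨u, hu⟩ := h γ hγ v (funext fun w => by
    have := hv (p w) (hp w)
    simp only [← eval_aeval] at this
    exact this)
  exact ⟨u, fun j => by simpa [J, Matrix.mulVec, dotProduct] using congrFun hu j⟩

/-- A morphism of affine spaces whose differential is surjective at the general point is
dominant. -/
theorem aeval_injective_of_forall_surjective [CharZero k] [Fintype σ] [Fintype τ]
    (φ : τ → MvPolynomial σ k) (q : MvPolynomial σ k) (hq : q ≠ 0)
    (h : ∀ γ, eval γ q ≠ 0 → ∀ v : τ → k, ∃ u : σ → k, ∀ j,
      v j = ∑ i, eval γ (pderiv i (φ j)) * u i) (p : MvPolynomial τ k) (hp : aeval φ p = 0) :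
    p = 0 := by
  classical
  -- Differentiating a relation along the source shows that its gradient kills the image of the
  -- differential, which is everything; so partial derivatives of relations are relations, and
  -- induction on the degree applies.
  have hpd : ∀ p : MvPolynomial τ k, aeval φ p = 0 → ∀ j, aeval φ (pderiv j p) = 0 := by
    intro p hp j
    have h0 : q * aeval φ (pderiv j p) = 0 := by
      have : Infinite k := CharZero.infinite k
      refine MvPolynomial.funext fun γ => ?_
      rw [map_mul, map_zero, mul_eq_zero, or_iff_not_imp_left]
      intro hγ
      obtain ⟨u, hu⟩ := h γ hγ (Pi.single j 1)
      have h1 : ∑ l, eval γ (aeval φ (pderiv l p)) * (Pi.single j 1 : τ → k) l = 0 := by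
        simp only [hu, Finset.mul_sum]
        rw [Finset.sum_comm]
        refine Finset.sum_eq_zero fun i _ => ?_
        have h2 := congrArg (eval γ) (aeval_pderiv_chain φ (pderiv i) p)
        rw [hp, map_zero, map_zero, map_sum] at h2
        simp only [map_mul] at h2
        simp only [← mul_assoc, ← Finset.sum_mul, ← h2, zero_mul]
      simpa only [Pi.single_apply, mul_ite, mul_one, mul_zero, Finset.sum_ite_eq',
        Finset.mem_univ, if_true] using h1
    exact (mul_eq_zero.mp h0).resolve_left hq
  induction hn : p.totalDegree using Nat.strong_induction_on generalizing p with
  | _ n ih =>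
  have hcoeff : ∀ j, pderiv j p = 0 := by
    intro j
    by_contra hne
    obtain ⟨m, hm⟩ := exists_coeff_ne_zero hne
    have h1 : ∀ m', coeff m' (pderiv j p) ≠ 0 → m'.degree + 1 ≤ n := fun m' hm' => by
      rw [coeff_pderiv] at hm'
      have := le_totalDegree (mem_support_iff.mpr (left_ne_zero_of_mul hm'))
      change (m' + Finsupp.single j 1).degree ≤ _ at this
      rwa [map_add, Finsupp.degree_single, hn] at this
    refine hne (ih (pderiv j p).totalDegree ?_ _ (hpd p hp j) rfl)
    have h2 := h1 m hm
    refine (Finset.sup_lt_iff (by simp; omega)).mpr fun m' hm' => ?_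
    exact h1 m' (mem_support_iff.mp hm')
  have hconst : p = C (coeff 0 p) := by
    ext m
    rw [coeff_C]
    split_ifs with h0
    · rw [h0]
    · obtain ⟨j, hj⟩ := Finsupp.ne_iff.mp (Ne.symm h0)
      have h1 : m - Finsupp.single j 1 + Finsupp.single j 1 = m :=
        tsub_add_cancel_of_le (by simpa [Nat.one_le_iff_ne_zero] using hj)
      have h2 := coeff_pderiv (i := j) p (m - Finsupp.single j 1)
      rw [hcoeff j, coeff_zero, h1] at h2
      exact (mul_eq_zero.mp h2.symm).resolve_right (Nat.cast_add_one_ne_zero _)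
  rw [hconst] at hp ⊢
  rw [algHom_C, algebraMap_eq, C_eq_zero] at hp
  rw [hp, C_0]

end Tangent

/-! ### Openness of exactness in affine families of linear maps. -/

section AffineFamily

variable {k σ : Type*} [Field k] [Fintype σ]

/-- The matrix of polynomials describing a family of linear maps that depends affinely on
parameters. -/
noncomputable def affineFamilyMatrix {m n : Type*} (N₀ : Matrix m n k)
    (N₁ : σ → Matrix m n k) : Matrix m n (MvPolynomial σ k) :=
  Matrix.of fun i j => C (N₀ i j) + ∑ s, C (N₁ s i j) * X s

theorem affineFamilyMatrix_map_eval [DecidableEq σ] {V W ι κ : Type*} [Fintype ι] [DecidableEq ι]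
    [Fintype κ] [DecidableEq κ] [AddCommGroup V] [Module k V] [AddCommGroup W] [Module k W]
    (bV : Module.Basis ι k V) (bW : Module.Basis κ k W)
    (A₀ : V →ₗ[k] W) (A₁ : (σ → k) →ₗ[k] V →ₗ[k] W) (γ : σ → k) :
    (affineFamilyMatrix (LinearMap.toMatrix bV bW A₀)
      fun s => LinearMap.toMatrix bV bW (A₁ (Pi.single s 1))).map (eval γ) =
      LinearMap.toMatrix bV bW (A₀ + A₁ γ) := by
  have h : A₁ γ = ∑ s, γ s • A₁ (Pi.single s 1) := by
    conv_lhs => rw [← Finset.univ_sum_single γ, map_sum]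
    refine Finset.sum_congr rfl fun s _ => ?_
    rw [← map_smul, ← Pi.single_smul, smul_eq_mul, mul_one]
  ext i j
  simp [affineFamilyMatrix, h, mul_comm, Matrix.sum_apply]

/-- Exactness of a complex of linear maps depending affinely on parameters is an open condition. -/
theorem exists_forall_exact_of_affine_family [Infinite k] {U V W : Type*}
    [AddCommGroup U] [Module k U] [Module.Finite k U]
    [AddCommGroup V] [Module k V] [Module.Finite k V]
    [AddCommGroup W] [Module k W] [Module.Finite k W]
    (A₀ : V →ₗ[k] W) (A₁ : (σ → k) →ₗ[k] V →ₗ[k] W)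
    (B₀ : U →ₗ[k] V) (B₁ : (σ → k) →ₗ[k] U →ₗ[k] V)
    (h0 : ∀ γ u, (A₀ + A₁ γ) ((B₀ + B₁ γ) u) = 0) (γ₀ : σ → k)
    (h : ∀ v, (A₀ + A₁ γ₀) v = 0 → ∃ u, v = (B₀ + B₁ γ₀) u) :
    ∃ q : MvPolynomial σ k, q ≠ 0 ∧ ∀ γ, eval γ q ≠ 0 →
      ∀ v, (A₀ + A₁ γ) v = 0 → ∃ u, v = (B₀ + B₁ γ) u := by
  classical
  let bU := Module.finBasis k U
  let bV := Module.finBasis k V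
  let bW := Module.finBasis k W
  let N := affineFamilyMatrix (LinearMap.toMatrix bV bW A₀)
    fun s => LinearMap.toMatrix bV bW (A₁ (Pi.single s 1))
  let J := affineFamilyMatrix (LinearMap.toMatrix bU bV B₀)
    fun s => LinearMap.toMatrix bU bV (B₁ (Pi.single s 1))
  have hN : ∀ γ, N.map (eval γ) = LinearMap.toMatrix bV bW (A₀ + A₁ γ) :=
    affineFamilyMatrix_map_eval bV bW A₀ A₁
  have hJ : ∀ γ, J.map (eval γ) = LinearMap.toMatrix bU bV (B₀ + B₁ γ) :=
    affineFamilyMatrix_map_eval bU bV B₀ B₁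
  have hiff : ∀ γ, (∀ v, (A₀ + A₁ γ) v = 0 → ∃ u, v = (B₀ + B₁ γ) u) ↔
      ∀ v, (N.map (eval γ)).mulVec v = 0 → ∃ u, v = (J.map (eval γ)).mulVec u := by
    intro γ
    rw [hN, hJ]
    constructor
    · intro H v hv
      obtain ⟨v, rfl⟩ := bV.equivFun.surjective v
      rw [Module.Basis.equivFun_apply, LinearMap.toMatrix_mulVec_repr] at hv
      obtain ⟨u, hu⟩ := H v (bW.equivFun.injective (by
        rw [Module.Basis.equivFun_apply, hv, map_zero]))
      refine ⟨bU.repr u, ?_⟩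
      rw [LinearMap.toMatrix_mulVec_repr, ← hu, Module.Basis.equivFun_apply]
    · intro H v hv
      obtain ⟨u, hu⟩ := H (bV.repr v) (by
        rw [LinearMap.toMatrix_mulVec_repr, hv, map_zero]; rfl)
      obtain ⟨u, rfl⟩ := bU.equivFun.surjective u
      rw [Module.Basis.equivFun_apply, LinearMap.toMatrix_mulVec_repr] at hu
      exact ⟨u, bV.equivFun.injective hu⟩
  have hNJ : N * J = 0 := by
    ext1 i j
    refine MvPolynomial.funext fun γ => ?_
    have : (N * J).map (eval γ) = 0 := by
      rw [Matrix.map_mul, hN, hJ, ← LinearMap.toMatrix_comp,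
        show (A₀ + A₁ γ) ∘ₗ (B₀ + B₁ γ) = 0 from LinearMap.ext (h0 γ), map_zero]
    simpa using congrFun (congrFun this i) j
  obtain ⟨q, hq, H⟩ := exists_forall_exact_of_point N J hNJ γ₀ ((hiff γ₀).mp h)
  exact ⟨q, hq, fun γ hγ => (hiff γ).mpr (H γ hγ)⟩

end AffineFamily

/-! ### Coordinates on forms and the sum of squares map. -/

variable {n d e r : ℕ}

noncomputable instance : Fintype (Exponent n d) :=
  (Finsupp.finite_of_degree_eq d : {f : Fin (n + 1) →₀ ℕ | f.degree = d}.Finite).fintype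

theorem form_coeff_eq_zero (f : Form n d) {m : Fin (n + 1) →₀ ℕ} (hm : m.degree ≠ d) :
    coeff m f.1 = 0 :=
  ((mem_homogeneousSubmodule d f.1).mp f.2).coeff_eq_zero hm

theorem form_ext_coeff {f g : Form n d} (h : ∀ m : Exponent n d, coeff m.1 f.1 = coeff m.1 g.1) :
    f = g := by
  refine Subtype.ext (MvPolynomial.ext _ _ fun m => ?_)
  by_cases hm : m.degree = d
  · exact h ⟨m, hm⟩
  · rw [form_coeff_eq_zero f hm, form_coeff_eq_zero g hm]

/-- The monomial with a given exponent, as a form. -/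
noncomputable def monomialForm (m : Exponent n d) : Form n d :=
  ⟨monomial m.1 1, (mem_homogeneousSubmodule d _).mpr (isHomogeneous_monomial 1 m.2)⟩

/-- A form of degree `d` is the same as the family of its coefficients. -/
noncomputable def coordsEquiv (n d : ℕ) : Form n d ≃ₗ[ℂ] (Exponent n d → ℂ) where
  toFun := coords
  map_add' f g := by ext; simp [coords]
  map_smul' c f := by ext; simp [coords]
  invFun v := ∑ m, v m • monomialForm m
  left_inv f := form_ext_coeff fun m => by
    classical
    simp [coords, monomialForm, coeff_sum, coeff_monomial, Subtype.val_inj]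
  right_inv v := by
    classical
    ext m
    simp [coords, monomialForm, coeff_sum, coeff_monomial, Subtype.val_inj]

instance : Module.Finite ℂ (Form n d) := Module.Finite.equiv (coordsEquiv n d).symm

/-- The `r`-tuple of forms with given coefficients. -/
noncomputable def tupleOfCoords (n e r : ℕ) :
    (Fin r × Exponent n e → ℂ) ≃ₗ[ℂ] (Fin r → Form n e) :=
  (LinearEquiv.curry ℂ ℂ (Fin r) (Exponent n e)).trans
    (LinearEquiv.piCongrRight fun _ => (coordsEquiv n e).symm)

theorem tupleOfCoords_apply (γ : Fin r × Exponent n e → ℂ) (i : Fin r) :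
    (tupleOfCoords n e r γ i).1 = ∑ a : Exponent n e, monomial a.1 (γ (i, a)) := by
  change (∑ a, γ (i, a) • monomialForm a : Form n e).1 = _
  simp [monomialForm, smul_monomial]

/-- The `i`-th member of the generic `r`-tuple of forms of degree `e`. -/
noncomputable def genericForm (n e : ℕ) {r : ℕ} (i : Fin r) :
    MvPolynomial (Fin (n + 1)) (MvPolynomial (Fin r × Exponent n e) ℂ) :=
  ∑ a : Exponent n e, monomial a.1 (X (i, a))

theorem map_eval_genericForm (γ : Fin r × Exponent n e → ℂ) (i : Fin r) :
    map (eval γ) (genericForm n e i) = (tupleOfCoords n e r γ i).1 := by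
  simp [genericForm, tupleOfCoords_apply, map_monomial]

/-- The coefficients of the sum of squares of the generic `r`-tuple of forms of degree `e`. -/
noncomputable def sumSqCoords (n d e r : ℕ) (m : Exponent n d) :
    MvPolynomial (Fin r × Exponent n e) ℂ :=
  coeff m.1 (∑ i : Fin r, genericForm n e i ^ 2)

theorem eval_sumSqCoords (γ : Fin r × Exponent n e → ℂ) (m : Exponent n d) :
    eval γ (sumSqCoords n d e r m) = coeff m.1 (∑ i, (tupleOfCoords n e r γ i).1 ^ 2) := by
  simp only [sumSqCoords, ← coeff_map, map_sum, map_pow, map_eval_genericForm]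

theorem pderiv_coeff_genericForm (s : Fin r × Exponent n e) (i : Fin r)
    (m : Fin (n + 1) →₀ ℕ) :
    pderiv s (coeff m (genericForm n e i)) =
      coeff m (monomial s.2.1 (if s.1 = i then 1 else 0)) := by
  classical
  simp only [genericForm, coeff_sum, coeff_monomial, map_sum, apply_ite (pderiv s), pderiv_X,
    map_zero, Pi.single_apply, Prod.ext_iff]
  rw [Finset.sum_eq_single s.2]
  · by_cases h : i = s.1 <;> simp [h, eq_comm]
  · intro b _ hb
    simp [hb]
  · simp

theorem pderiv_sumSqCoords (s : Fin r × Exponent n e) (m : Exponent n d) :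
    pderiv s (sumSqCoords n d e r m) =
      coeff m.1 (2 * (genericForm n e s.1 * monomial s.2.1 1)) := by
  have h : ∀ i, pderiv s (coeff m.1 (genericForm n e i ^ 2)) =
      coeff m.1 (2 * (genericForm n e i * monomial s.2.1 (if s.1 = i then 1 else 0))) := by
    intro i
    rw [two_mul]
    nth_rw 2 [mul_comm]
    rw [pow_two, coeff_add, coeff_mul, coeff_mul, coeff_mul, map_sum, ← Finset.sum_add_distrib]
    refine Finset.sum_congr rfl fun x _ => ?_
    rw [Derivation.leibniz, pderiv_coeff_genericForm, pderiv_coeff_genericForm, smul_eq_mul,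
      smul_eq_mul]
    ring
  rw [sumSqCoords, coeff_sum, map_sum]
  simp only [h]
  rw [Finset.sum_eq_single s.1]
  · simp
  · intro i _ hi
    simp [hi.symm]
  · simp

theorem sum_eval_pderiv_sumSqCoords (γ u : Fin r × Exponent n e → ℂ) (m : Exponent n d) :
    ∑ s, eval γ (pderiv s (sumSqCoords n d e r m)) * u s =
      coeff m.1 (2 * ∑ i, (tupleOfCoords n e r γ i).1 * (tupleOfCoords n e r u i).1) := by
  have h : ∀ s, eval γ (pderiv s (sumSqCoords n d e r m)) * u s =
      coeff m.1 (2 * ((tupleOfCoords n e r γ s.1).1 * monomial s.2.1 (u s))) := by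
    intro s
    rw [pderiv_sumSqCoords, ← coeff_map, map_mul, map_mul, map_eval_genericForm, map_monomial,
      map_one, map_ofNat]
    have : monomial s.2.1 (u s) = C (u s) * monomial s.2.1 (1 : ℂ) := by
      rw [C_mul_monomial, mul_one]
    rw [this, mul_comm, ← coeff_C_mul]
    congr 1
    ring
  simp only [h, ← coeff_sum, ← Finset.mul_sum, Fintype.sum_prod_type, tupleOfCoords_apply]

theorem isHomogeneous_form (f : Form n d) : f.1.IsHomogeneous d :=
  (mem_homogeneousSubmodule d f.1).mp f.2

/-- Multiplication of forms. -/
noncomputable def mulForm (hd : e + e = d) : Form n e →ₗ[ℂ] Form n e →ₗ[ℂ] Form n d :=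
  LinearMap.mk₂ ℂ
    (fun f g => ⟨f.1 * g.1, (mem_homogeneousSubmodule d _).mpr
      (hd ▸ (isHomogeneous_form f).mul (isHomogeneous_form g))⟩)
    (fun f f' g => Subtype.ext (add_mul f.1 f'.1 g.1))
    (fun c f g => Subtype.ext (smul_mul_assoc c f.1 g.1))
    (fun f g g' => Subtype.ext (mul_add f.1 g.1 g'.1))
    (fun c f g => Subtype.ext (mul_smul_comm c f.1 g.1))

theorem mulForm_coe (hd : e + e = d) (f g : Form n e) : (mulForm hd f g).1 = f.1 * g.1 := rfl

/-- The sum of the squares of a tuple of forms. -/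
noncomputable def sumSq (hd : e + e = d) (g : Fin r → Form n e) : Form n d :=
  ∑ i, mulForm hd (g i) (g i)

theorem sumSq_coe (hd : e + e = d) (g : Fin r → Form n e) :
    (sumSq hd g).1 = ∑ i, (g i).1 ^ 2 := by
  simp [sumSq, mulForm_coe, pow_two]

theorem coords_sumSq (hd : e + e = d) (γ : Fin r × Exponent n e → ℂ) :
    coords (sumSq hd (tupleOfCoords n e r γ)) = fun m => eval γ (sumSqCoords n d e r m) := by
  ext m
  rw [eval_sumSqCoords, ← sumSq_coe hd]
  rfl

theorem mem_openSecant_iff (hd : d / 2 + d / 2 = d) {f : Form n d} :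
    f ∈ openSecant n d r ↔ ∃ γ, f = sumSq hd (tupleOfCoords n (d / 2) r γ) := by
  constructor
  · rintro ⟨g, hg⟩
    obtain ⟨γ, rfl⟩ := (tupleOfCoords n (d / 2) r).surjective g
    exact ⟨γ, Subtype.ext (hg.trans (sumSq_coe hd _).symm)⟩
  · rintro ⟨γ, rfl⟩
    exact ⟨_, sumSq_coe hd _⟩

theorem vanishes_on_openSecant_iff (hd : d / 2 + d / 2 = d) (p : MvPolynomial (Exponent n d) ℂ) :
    (∀ g ∈ openSecant n d r, eval (coords g) p = 0) ↔
      aeval (sumSqCoords n d (d / 2) r) p = 0 := by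
  constructor
  · intro h
    refine MvPolynomial.funext fun γ => ?_
    rw [eval_aeval, map_zero, ← coords_sumSq hd]
    exact h _ ((mem_openSecant_iff hd).mpr ⟨γ, rfl⟩)
  · intro h g hg
    obtain ⟨γ, rfl⟩ := (mem_openSecant_iff hd).mp hg
    rw [coords_sumSq, ← eval_aeval, h, map_zero]

theorem mem_secant_iff (hd : d / 2 + d / 2 = d) {f : Form n d} :
    f ∈ secant n d r ↔ ∀ p : MvPolynomial (Exponent n d) ℂ,
      aeval (sumSqCoords n d (d / 2) r) p = 0 → eval (coords f) p = 0 :=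
  forall_congr' fun p => imp_congr_left (vanishes_on_openSecant_iff hd p)

/-! ### From tangent spaces to orthogonal matrices. -/

/-- For the general tuple `g`, the image of the differential of the sum of squares map at any
other tuple in the same fibre is contained in the degree `2e` part of the ideal generated by
`g`. -/
theorem exists_forall_image_differential_le (n e r : ℕ) :
    ∃ q : MvPolynomial (Fin r × Exponent n e) ℂ, q ≠ 0 ∧ ∀ γ, eval γ q ≠ 0 →
      ∀ h : Fin r → Form n e, ∑ i, (h i).1 ^ 2 = ∑ i, (tupleOfCoords n e r γ i).1 ^ 2 →
      ∀ k : Fin r → Form n e, ∃ l : Fin r → Form n e,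
        ∑ i, (h i).1 * (k i).1 = ∑ i, (tupleOfCoords n e r γ i).1 * (l i).1 := by
  obtain ⟨q, hq, H⟩ := exists_forall_tangent_eq_image (sumSqCoords n (e + e) e r)
  refine ⟨q, hq, fun γ hγ h hh k => ?_⟩
  obtain ⟨η, rfl⟩ := (tupleOfCoords n e r).surjective h
  obtain ⟨u, rfl⟩ := (tupleOfCoords n e r).surjective k
  have hφ : (fun m => eval γ (sumSqCoords n (e + e) e r m)) =
      fun m => eval η (sumSqCoords n (e + e) e r m) := by
    ext m
    rw [eval_sumSqCoords, eval_sumSqCoords, hh]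
  -- The tangent equations depend only on the image point, which is the same for `η` and `γ`; a
  -- vector in the image of the differential at `η` satisfies them by the chain rule.
  obtain ⟨w, hw⟩ := H γ hγ
    (fun m => ∑ s, eval η (pderiv s (sumSqCoords n (e + e) e r m)) * u s) (fun p hp => by
      simp only [hφ, Finset.mul_sum]
      rw [Finset.sum_comm]
      refine Finset.sum_eq_zero fun s _ => ?_
      have h2 := congrArg (eval η) (aeval_pderiv_chain (sumSqCoords n (e + e) e r) (pderiv s) p)
      rw [hp, map_zero, map_zero, map_sum] at h2
      simp only [map_mul, eval_aeval] at h2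
      simp only [← mul_assoc, ← Finset.sum_mul, ← h2, zero_mul])
  refine ⟨tupleOfCoords n e r w, ?_⟩
  have h2 : (∑ i, mulForm rfl (tupleOfCoords n e r η i) (tupleOfCoords n e r u i) :
      Form n (e + e)) = ∑ i, mulForm rfl (tupleOfCoords n e r γ i) (tupleOfCoords n e r w i) := by
    refine form_ext_coeff fun m => ?_
    have := hw m
    have h2 : ∀ P : MvPolynomial (Fin (n + 1)) ℂ, coeff m.1 (2 * P) = 2 * coeff m.1 P :=
      fun P => by rw [two_mul, coeff_add, two_mul]
    rw [sum_eval_pderiv_sumSqCoords, sum_eval_pderiv_sumSqCoords, h2, h2] at this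
    simpa [mulForm_coe] using mul_left_cancel₀ two_ne_zero this
  simpa [mulForm_coe] using congrArg Subtype.val h2

/-- The only forms `h` of degree `e` such that `h * m ∈ (g₀, …, gᵣ₋₁)` for all monomials `m` of
degree `e` are the linear combinations of `g`, and all relations between the forms `g` with
coefficients of degree `e` are Koszul relations. -/
def KoszulExact (g : Fin r → Form n e) : Prop :=
  ∀ (h : Form n e) (k : Exponent n e → Fin r → Form n e),
    (∀ m, h.1 * monomial m.1 1 = ∑ i, (k m i).1 * (g i).1) →
    ∃ (c : Fin r → ℂ) (a : Exponent n e → Fin r → Fin r → ℂ), h = ∑ i, c i • g i ∧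
      ∀ m i, k m i = c i • monomialForm m + ∑ j, (a m i j - a m j i) • g j

instance : Nonempty (Exponent n d) := ⟨⟨Finsupp.single 0 d, by simp⟩⟩

/-- Tangency puts each `h i` in the span of `g`, giving `A`; the equality of sums of squares makes
AᵀA - 1 a relation, symmetric by construction and antisymmetric because it is Koszul. -/
theorem exists_orthogonal_of_koszulExact (g h : Fin r → Form n e)
    (hlin : LinearIndependent ℂ g) (hg : KoszulExact g)
    (heq : ∑ i, (h i).1 ^ 2 = ∑ i, (g i).1 ^ 2)
    (htan : ∀ k : Fin r → Form n e, ∃ l : Fin r → Form n e,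
      ∑ i, (h i).1 * (k i).1 = ∑ i, (g i).1 * (l i).1) :
    ∃ A ∈ Matrix.orthogonalGroup (Fin r) ℂ, h = act A g := by
  have hspan : ∀ i, ∃ c : Fin r → ℂ, h i = ∑ j, c j • g j := by
    intro i
    have : ∀ m : Exponent n e, ∃ l : Fin r → Form n e,
        (h i).1 * monomial m.1 1 = ∑ j, (l j).1 * (g j).1 := fun m => by
      obtain ⟨l, hl⟩ := htan (Pi.single i (monomialForm m))
      refine ⟨l, ?_⟩
      rw [Finset.sum_eq_single i (fun j _ hj => by simp [hj]) (by simp), Pi.single_eq_same] at hl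
      exact hl.trans (Finset.sum_congr rfl fun j _ => mul_comm _ _)
    choose k hk using this
    obtain ⟨c, -, hc, -⟩ := hg (h i) k hk
    exact ⟨c, hc⟩
  choose c hc using hspan
  let A : Matrix (Fin r) (Fin r) ℂ := Matrix.of c
  refine ⟨A, ?_, funext hc⟩
  let S := A.transpose * A - 1
  have hS : ∑ i, (∑ j, S i j • g j : Form n e).1 * (g i).1 = 0 := by
    have h1 : ∑ i, (h i).1 ^ 2 =
        ∑ i, ∑ j, ∑ l, (A i l * A i j) • ((g j).1 * (g l).1) := by
      refine Finset.sum_congr rfl fun i _ => ?_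
      rw [hc i, pow_two]
      simp only [Submodule.coe_sum, Submodule.coe_smul, Finset.sum_mul_sum, smul_mul_smul_comm]
      refine Finset.sum_congr rfl fun j _ => Finset.sum_congr rfl fun l _ => ?_
      rw [mul_comm]; rfl
    have h2 : ∀ i, (∑ j, S i j • g j : Form n e).1 * (g i).1 =
        ∑ j, ∑ l, (A l i * A l j) • ((g j).1 * (g i).1) - (g i).1 ^ 2 := by
      intro i
      simp only [S, Submodule.coe_sum, Submodule.coe_smul, Matrix.sub_apply, sub_smul,
        Finset.sum_sub_distrib, Finset.sum_mul, sub_mul, Matrix.mul_apply, Matrix.transpose_apply,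
        Finset.sum_smul, smul_mul_assoc, Matrix.one_apply, ite_smul, one_smul, zero_smul,
        Finset.sum_ite_eq, Finset.mem_univ, if_true, pow_two]
    rw [Finset.sum_congr rfl fun i _ => h2 i, Finset.sum_sub_distrib, ← heq, h1, sub_eq_zero]
    rw [Finset.sum_comm, Finset.sum_congr rfl fun j _ => Finset.sum_comm, Finset.sum_comm]
  obtain ⟨m⟩ : Nonempty (Exponent n e) := inferInstance
  -- With zero as the form, the hypothesis concerns pure relations; the same relation is used for
  -- every monomial `m`.
  obtain ⟨b, a, hb, hk⟩ := hg 0 (fun _ i => ∑ j, S i j • g j) (fun m => by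
    rw [hS]; simp)
  have hb0 : b = 0 := funext (Fintype.linearIndependent_iff.mp hlin b hb.symm)
  have hanti : ∀ i j, S i j = a m i j - a m j i := by
    intro i j
    have h1 : ∑ j, (S i j - (a m i j - a m j i)) • g j = 0 := by
      have := hk m i
      rw [hb0, Pi.zero_apply, zero_smul, zero_add] at this
      rw [Finset.sum_congr rfl fun j _ => sub_smul (S i j) (a m i j - a m j i) (g j),
        Finset.sum_sub_distrib, this, sub_self]
    exact sub_eq_zero.mp (Fintype.linearIndependent_iff.mp hlin _ h1 j)
  have hsymm : ∀ i j, S i j = S j i := by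
    intro i j
    have : S.transpose = S := by simp [S, Matrix.transpose_mul]
    exact (congrFun (congrFun this j) i)
  rw [Matrix.mem_orthogonalGroup_iff', ← sub_eq_zero]
  ext i j
  change S i j = 0
  have h1 := hanti i j
  have h2 := hanti j i
  rw [← hsymm i j] at h2
  linear_combination (h1 + h2) / 2

theorem act_mul (A B : Matrix (Fin r) (Fin r) ℂ) (g : Fin r → Form n e) :
    act (A * B) g = act A (act B g) := by
  ext1 i
  simp only [act, Matrix.mul_apply, Finset.sum_smul, Finset.smul_sum, smul_smul]
  exact Finset.sum_comm

/-- A shorter decomposition padded with zeros would be `act A g` with `A` orthogonal, yet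
independence of `g` forces a zero row in `A`. Two decompositions `A g` and `B g` differ by `B * Aᵀ`.
-/
theorem isOIdentifiable_of_forall (f : Form n d) (g : Fin r → Form n (d / 2))
    (hlin : LinearIndependent ℂ g) (hfg : g ∈ SOS r f)
    (H : ∀ h ∈ SOS r f, ∃ A ∈ Matrix.orthogonalGroup (Fin r) ℂ, h = act A g) :
    IsOIdentifiable r f := by
  refine ⟨⟨⟨g, hfg⟩, ?_⟩, fun h hh h' hh' => ?_⟩
  · rintro s ⟨h, hh⟩
    by_contra! hlt
    obtain ⟨t, rfl⟩ := Nat.exists_eq_add_of_lt hlt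
    obtain ⟨A, hA, hhA⟩ := H (Fin.append (n := t + 1) h 0) (by
      change f.1 = ∑ i : Fin (s + (t + 1)), _
      rw [Fin.sum_univ_add]
      simpa using show f.1 = ∑ i, (h i).1 ^ 2 from hh)
    have h1 := congrFun hhA (Fin.natAdd s (Fin.last t))
    rw [Fin.append_right] at h1
    have h2 := Fintype.linearIndependent_iff.mp hlin _ h1.symm
    have h3 := congrFun (congrFun (Matrix.mem_orthogonalGroup_iff _ _ |>.mp hA)
      (Fin.natAdd s (Fin.last t))) (Fin.natAdd s (Fin.last t))
    rw [Matrix.mul_apply, Matrix.one_apply_eq,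
      Finset.sum_eq_zero fun j _ => by rw [h2 j, zero_mul]] at h3
    exact zero_ne_one h3
  · obtain ⟨A, hA, rfl⟩ := H h hh
    obtain ⟨B, hB, rfl⟩ := H h' hh'
    have hA' := (Matrix.mem_orthogonalGroup_iff' _ _).mp hA
    refine ⟨B * A.transpose, mul_mem hB ?_, ?_⟩
    · rw [Matrix.mem_orthogonalGroup_iff, Matrix.transpose_transpose, hA']
    · rw [← act_mul, mul_assoc, hA', mul_one]

/-- If the general `r`-tuple of forms is linearly independent and Koszul exact, then the secant
variety is generically `O(r)`-identifiable. -/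
theorem genericallyOIdentifiable_of_forall (hd : d / 2 + d / 2 = d)
    (q : MvPolynomial (Fin r × Exponent n (d / 2)) ℂ) (hq : q ≠ 0)
    (H : ∀ γ, eval γ q ≠ 0 → LinearIndependent ℂ (tupleOfCoords n (d / 2) r γ) ∧
      KoszulExact (tupleOfCoords n (d / 2) r γ)) :
    GenericallyOIdentifiable n d r := by
  obtain ⟨q', hq', H'⟩ := exists_forall_image_differential_le n (d / 2) r
  obtain ⟨p, hp, hpγ⟩ := exists_eval_eq_of_mem_basicOpen (sumSqCoords n d (d / 2) r) (q * q')
    (mul_ne_zero hq hq')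
  refine ⟨{f | eval (coords f) p ≠ 0}, ⟨{p}, ?_⟩, ?_, ?_⟩
  · ext f; simp
  -- If `s` vanishes on the part of the secant variety where `p ≠ 0`, then `s * p` vanishes on all
  -- sums of squares. Its pullback is zero in a domain where that of `p` is not.
  · intro f hf s hs
    refine (mem_secant_iff hd).mp hf s ?_
    refine (mul_eq_zero.mp ?_).resolve_right hp
    rw [← map_mul, ← vanishes_on_openSecant_iff hd]
    intro g hg
    rw [map_mul, mul_eq_zero, or_iff_not_imp_right]
    exact fun hgp => hs g ⟨fun t ht => ht g hg, hgp⟩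
  · rintro f ⟨hf, hfp⟩
    obtain ⟨γ, hγ, hfγ⟩ := hpγ (coords f) ((mem_secant_iff hd).mp hf) hfp
    rw [map_mul, mul_ne_zero_iff] at hγ
    have hfg : f = sumSq hd (tupleOfCoords n (d / 2) r γ) :=
      form_ext_coeff fun m => (hfγ m).trans (congrFun (coords_sumSq hd γ) m).symm
    have hfg' : f.1 = ∑ i, (tupleOfCoords n (d / 2) r γ i).1 ^ 2 := by rw [hfg, sumSq_coe]
    obtain ⟨hlin, hex⟩ := H γ hγ.1
    refine isOIdentifiable_of_forall f _ hlin hfg' fun h hh => ?_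
    have heq := hh.symm.trans hfg'
    exact exists_orthogonal_of_koszulExact _ h hlin hex heq (H' γ hγ.2 h heq)

/-! ### Independence, Koszul exactness and generation as open conditions. -/

theorem exists_forall_linearIndependent (γ₀ : Fin r × Exponent n e → ℂ)
    (h : LinearIndependent ℂ (tupleOfCoords n e r γ₀)) :
    ∃ q : MvPolynomial (Fin r × Exponent n e) ℂ, q ≠ 0 ∧
      ∀ γ, eval γ q ≠ 0 → LinearIndependent ℂ (tupleOfCoords n e r γ) := by
  let A₁ : (Fin r × Exponent n e → ℂ) →ₗ[ℂ] (Fin r → ℂ) →ₗ[ℂ] Form n e :=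
    LinearMap.mk₂ ℂ (fun γ c => ∑ i, c i • tupleOfCoords n e r γ i)
      (fun γ γ' c => by simp [Finset.sum_add_distrib])
      (fun a γ c => by simp [Finset.smul_sum, smul_comm a])
      (fun γ c c' => by simp [add_smul, Finset.sum_add_distrib])
      (fun a γ c => by simp [Finset.smul_sum, mul_smul])
  obtain ⟨q, hq, H⟩ := exists_forall_exact_of_affine_family (U := Fin 0 → ℂ) 0 A₁ 0 0
    (fun γ u => by simp) γ₀ (fun v hv => ⟨0, by
      ext i
      simpa using Fintype.linearIndependent_iff.mp h v (by simpa [A₁] using hv) i⟩)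
  refine ⟨q, hq, fun γ hγ => Fintype.linearIndependent_iff.mpr fun c hc => ?_⟩
  obtain ⟨u, hu⟩ := H γ hγ c (by simpa [A₁] using hc)
  rw [hu]
  simp

/-- The linear part of the family of maps whose kernel describes Koszul exactness. -/
noncomputable def koszulRelationLinear (n e r : ℕ) : (Fin r × Exponent n e → ℂ) →ₗ[ℂ]
    (Form n e × (Exponent n e → Fin r → Form n e)) →ₗ[ℂ] (Exponent n e → Form n (e + e)) :=
  LinearMap.mk₂ ℂ (fun γ v m => ∑ i, mulForm rfl (v.2 m i) (tupleOfCoords n e r γ i))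
    (fun γ γ' v => funext fun m => by
      simp only [map_add, Pi.add_apply, Finset.sum_add_distrib])
    (fun a γ v => funext fun m => by
      simp only [map_smul, Pi.smul_apply, Finset.smul_sum])
    (fun γ v v' => funext fun m => by
      simp only [Prod.snd_add, map_add, Pi.add_apply, Finset.sum_add_distrib,
        LinearMap.add_apply])
    (fun a γ v => funext fun m => by
      simp only [Prod.smul_snd, map_smul, Pi.smul_apply, Finset.smul_sum, LinearMap.smul_apply])

/-- The constant part of the family of maps whose image describes Koszul exactness. -/
noncomputable def koszulSyzygyConst (n e r : ℕ) :
    ((Fin r → ℂ) × (Exponent n e → Fin r → Fin r → ℂ)) →ₗ[ℂ]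
      (Form n e × (Exponent n e → Fin r → Form n e)) where
  toFun u := (0, fun m i => u.1 i • monomialForm m)
  map_add' _ _ := Prod.ext (add_zero _).symm (funext₂ fun _ _ => add_smul _ _ _)
  map_smul' _ _ := Prod.ext (smul_zero _).symm (funext₂ fun _ _ => mul_smul _ _ _)

/-- The linear part of the family of maps whose image describes Koszul exactness. -/
noncomputable def koszulSyzygyLinear (n e r : ℕ) : (Fin r × Exponent n e → ℂ) →ₗ[ℂ]
    ((Fin r → ℂ) × (Exponent n e → Fin r → Fin r → ℂ)) →ₗ[ℂ]
      (Form n e × (Exponent n e → Fin r → Form n e)) :=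
  LinearMap.mk₂ ℂ (fun γ u => (∑ i, u.1 i • tupleOfCoords n e r γ i,
      fun m i => ∑ j, (u.2 m i j - u.2 m j i) • tupleOfCoords n e r γ j))
    (fun γ γ' u => Prod.ext
      (by simp only [map_add, Pi.add_apply, smul_add, Finset.sum_add_distrib, Prod.fst_add])
      (funext₂ fun m i => by
        simp only [map_add, Pi.add_apply, smul_add, Finset.sum_add_distrib, Prod.snd_add]))
    (fun a γ u => Prod.ext
      (by simp only [map_smul, Pi.smul_apply, smul_comm _ a, Finset.smul_sum, Prod.smul_fst])
      (funext₂ fun m i => by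
        simp only [map_smul, Pi.smul_apply, smul_comm _ a, Finset.smul_sum, Prod.smul_snd]))
    (fun γ u u' => Prod.ext
      (by simp only [Prod.fst_add, Pi.add_apply, add_smul, Finset.sum_add_distrib])
      (funext₂ fun m i => by
        simp only [Prod.snd_add, Pi.add_apply, add_smul, Finset.sum_add_distrib,
          add_sub_add_comm]))
    (fun a γ u => Prod.ext
      (by simp only [Prod.smul_fst, Pi.smul_apply, smul_eq_mul, mul_smul, Finset.smul_sum])
      (funext₂ fun m i => by
        simp only [Prod.smul_snd, Pi.smul_apply, smul_eq_mul, ← mul_sub, mul_smul,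
          Finset.smul_sum]))

theorem sum_koszul_eq_zero {R : Type*} [CommRing R] [Algebra ℂ R] (a : Fin r → Fin r → ℂ)
    (g : Fin r → R) : ∑ i, (∑ j, (a i j - a j i) • g j) * g i = 0 := by
  simp only [sub_smul, Finset.sum_sub_distrib, sub_mul, Finset.sum_mul, smul_mul_assoc]
  rw [sub_eq_zero, Finset.sum_comm]
  exact Finset.sum_congr rfl fun i _ => Finset.sum_congr rfl fun j _ => by rw [mul_comm]

/-- The condition is exactness in the middle of (c, a) ↦ (h, k) ↦ (∑ k_m,i g_i - h m)_m. The terms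
c_i m and -h m do not involve `g`, which is why affine rather than linear families are needed. -/
theorem exists_forall_koszulExact (γ₀ : Fin r × Exponent n e → ℂ)
    (h : KoszulExact (tupleOfCoords n e r γ₀)) :
    ∃ q : MvPolynomial (Fin r × Exponent n e) ℂ, q ≠ 0 ∧
      ∀ γ, eval γ q ≠ 0 → KoszulExact (tupleOfCoords n e r γ) := by
  let A₀ : (Form n e × (Exponent n e → Fin r → Form n e)) →ₗ[ℂ] (Exponent n e → Form n (e + e)) :=
    (LinearMap.pi fun m => (mulForm rfl).flip (-monomialForm m)) ∘ₗ LinearMap.fst ℂ _ _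
  let A₁ := koszulRelationLinear n e r
  let B₀ := koszulSyzygyConst n e r
  let B₁ := koszulSyzygyLinear n e r
  have hA : ∀ γ v, (A₀ + A₁ γ) v = 0 ↔ ∀ m, v.1.1 * monomial m.1 1 =
      ∑ i, (v.2 m i).1 * (tupleOfCoords n e r γ i).1 := by
    intro γ v
    rw [funext_iff]
    refine forall_congr' fun m => ?_
    change mulForm rfl v.1 (-monomialForm m) +
      ∑ i, mulForm rfl (v.2 m i) (tupleOfCoords n e r γ i) = 0 ↔ _
    rw [map_neg, neg_add_eq_zero, ← Subtype.val_inj]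
    simp [mulForm_coe, monomialForm]
  have hB : ∀ γ v, (∃ u, v = (B₀ + B₁ γ) u) ↔ ∃ (c : Fin r → ℂ)
      (a : Exponent n e → Fin r → Fin r → ℂ), v.1 = ∑ i, c i • tupleOfCoords n e r γ i ∧
      ∀ m i, v.2 m i = c i • monomialForm m +
        ∑ j, (a m i j - a m j i) • tupleOfCoords n e r γ j := by
    intro γ v
    rw [Prod.exists]
    refine exists_congr fun c => exists_congr fun a => ?_
    rw [Prod.ext_iff, funext_iff]
    simp only [funext_iff]
    change (v.1 = 0 + _ ∧ _) ↔ _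
    rw [zero_add]
    rfl
  obtain ⟨q, hq, H⟩ := exists_forall_exact_of_affine_family A₀ A₁ B₀ B₁
    (fun γ u => by
      rw [hA]
      intro m
      obtain ⟨c, a⟩ := u
      change (0 + ∑ i, c i • tupleOfCoords n e r γ i : Form n e).1 * _ = ∑ i,
        (c i • monomialForm m + ∑ j, (a m i j - a m j i) • tupleOfCoords n e r γ j : Form n e).1 *
          (tupleOfCoords n e r γ i).1
      have hk : ∑ i, (∑ j, (a m i j - a m j i) • tupleOfCoords n e r γ j : Form n e).1 *
          (tupleOfCoords n e r γ i).1 = 0 := by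
        simpa only [Submodule.coe_sum, Submodule.coe_smul] using
          sum_koszul_eq_zero (a m) fun i => (tupleOfCoords n e r γ i).1
      simp only [zero_add, Submodule.coe_add, add_mul, Finset.sum_add_distrib, hk, add_zero]
      simp only [Submodule.coe_sum, Submodule.coe_smul, Finset.sum_mul, smul_mul_assoc]
      exact Finset.sum_congr rfl fun i _ => by rw [mul_comm]; rfl) γ₀ (fun v hv => (hB γ₀ v).mpr (h v.1 v.2 ((hA γ₀ v).mp hv)))
  exact ⟨q, hq, fun γ hγ f k hfk => (hB γ (f, k)).mp (H γ hγ (f, k) ((hA γ (f, k)).mpr hfk))⟩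

/-- If the forms `g` generate all forms of degree `d`, then sums of `r` squares are dense. -/
theorem secant_eq_univ_of_surjective (hd : d / 2 + d / 2 = d) (g : Fin r → Form n (d / 2))
    (hg : ∀ f : Form n d, ∃ k : Fin r → Form n (d / 2), f.1 = ∑ i, (g i).1 * (k i).1) :
    secant n d r = Set.univ := by
  obtain ⟨γ₀, rfl⟩ := (tupleOfCoords n (d / 2) r).surjective g
  let B₁ : (Fin r × Exponent n (d / 2) → ℂ) →ₗ[ℂ] (Fin r → Form n (d / 2)) →ₗ[ℂ] Form n d :=
    LinearMap.mk₂ ℂ (fun γ k => ∑ i, mulForm hd (tupleOfCoords n (d / 2) r γ i) (k i))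
      (fun γ γ' k => by simp [Finset.sum_add_distrib])
      (fun a γ k => by simp [Finset.smul_sum])
      (fun γ k k' => by simp [Finset.sum_add_distrib])
      (fun a γ k => by simp [Finset.smul_sum])
  obtain ⟨q, hq, H⟩ := exists_forall_exact_of_affine_family (W := Fin 0 → ℂ) 0 0 0 B₁
    (fun γ u => by simp) γ₀ (fun f _ => by
      obtain ⟨k, hk⟩ := hg f
      exact ⟨k, Subtype.ext (by simpa [B₁, mulForm_coe] using hk)⟩)
  refine Set.eq_univ_of_forall fun f => (mem_secant_iff hd).mpr fun p hp => ?_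
  rw [aeval_injective_of_forall_surjective (sumSqCoords n d (d / 2) r) q hq ?_ p hp, map_zero]
  intro γ hγ v
  -- The factor 1/2 cancels the 2 in the differential of a square.
  obtain ⟨k, hk⟩ := H γ hγ ((coordsEquiv n d).symm ((2 : ℂ)⁻¹ • v)) (by simp)
  obtain ⟨u, rfl⟩ := (tupleOfCoords n (d / 2) r).surjective k
  refine ⟨u, fun m => ?_⟩
  have h1 := congrFun (congrArg (coordsEquiv n d) hk) m
  rw [LinearEquiv.apply_symm_apply] at h1
  have h2 : ∀ P : MvPolynomial (Fin (n + 1)) ℂ, coeff m.1 (2 * P) = 2 * coeff m.1 P :=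
    fun P => by rw [two_mul, coeff_add, two_mul]
  rw [sum_eval_pderiv_sumSqCoords, h2]
  have h3 : (coordsEquiv n d) ((0 + B₁ γ) (tupleOfCoords n (d / 2) r u)) m =
      coeff m.1 (∑ i, (tupleOfCoords n (d / 2) r γ i).1 * (tupleOfCoords n (d / 2) r u i).1) := by
    simp [coordsEquiv, coords, B₁, mulForm_coe, coeff_sum]
  rw [← h3, ← h1, Pi.smul_apply, smul_eq_mul, mul_inv_cancel_left₀ two_ne_zero]

/-! ### Pure powers of variables. -/

/-- The `e`-th powers of some of the variables. -/
noncomputable def powerTuple (e : ℕ) (ι : Fin r → Fin (n + 1)) (i : Fin r) : Form n e :=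
  monomialForm ⟨Finsupp.single (ι i) e, by simp⟩

theorem powerTuple_coe (ι : Fin r → Fin (n + 1)) (i : Fin r) :
    (powerTuple e ι i).1 = monomial (Finsupp.single (ι i) e) 1 := rfl

theorem coeff_powerTuple (ι : Fin r → Fin (n + 1)) (hι : ι.Injective) (he : 0 < e) (i j : Fin r) :
    coeff (Finsupp.single (ι j) e) (powerTuple e ι i).1 = if i = j then 1 else 0 := by
  classical
  rw [powerTuple_coe, coeff_monomial]
  congr 1
  rw [Finsupp.single_left_inj he.ne', hι.eq_iff]

theorem coeff_mul_powerTuple (ι : Fin r → Fin (n + 1)) (i : Fin r)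
    (p : MvPolynomial (Fin (n + 1)) ℂ) (ν : Fin (n + 1) →₀ ℕ) :
    coeff ν (p * (powerTuple e ι i).1) =
      if e ≤ ν (ι i) then coeff (ν - Finsupp.single (ι i) e) p else 0 := by
  rw [powerTuple_coe, coeff_mul_monomial', mul_one]
  simp only [Finsupp.single_le_iff]

theorem eq_single_of_le_of_degree {μ : Fin (n + 1) →₀ ℕ} {j : Fin (n + 1)} (hμ : μ.degree = e)
    (hj : e ≤ μ j) : μ = Finsupp.single j e := by
  have h1 : Finsupp.single j e ≤ μ := Finsupp.single_le_iff.mpr hj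
  have h2 : μ = μ - Finsupp.single j e + Finsupp.single j e := (tsub_add_cancel_of_le h1).symm
  have h3 := congrArg Finsupp.degree h2
  rw [map_add, Finsupp.degree_single, hμ] at h3
  have h4 : (μ - Finsupp.single j e).degree = 0 := by omega
  rw [Finsupp.degree_eq_zero_iff] at h4
  rw [h2, h4, zero_add]

theorem linearIndependent_powerTuple (ι : Fin r → Fin (n + 1)) (hι : ι.Injective) (he : 0 < e) :
    LinearIndependent ℂ (powerTuple e ι) := by
  refine Fintype.linearIndependent_iff.mpr fun c hc j => ?_
  have := congrArg (fun f : Form n e => coeff (Finsupp.single (ι j) e) f.1) hc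
  simpa [Submodule.coe_sum, coeff_sum, coeff_powerTuple ι hι he] using this

/-- Relations of degree `e` between the `e`-th powers of variables are Koszul relations. -/
theorem exists_antisymm_of_sum_mul_powerTuple_eq_zero (ι : Fin r → Fin (n + 1))
    (hι : ι.Injective) (he : 0 < e) (k : Fin r → Form n e)
    (hk : ∑ i, (k i).1 * (powerTuple e ι i).1 = 0) :
    ∃ a : Fin r → Fin r → ℂ, ∀ i, k i = ∑ j, (a i j - a j i) • powerTuple e ι j := by
  have hcoeff : ∀ ν, ∑ i, (if e ≤ ν (ι i) then coeff (ν - Finsupp.single (ι i) e) (k i).1 else 0) =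
      0 := fun ν => by
    have := congrArg (coeff ν) hk
    simpa only [coeff_sum, coeff_mul_powerTuple, coeff_zero] using this
  have hanti : ∀ i j, coeff (Finsupp.single (ι j) e) (k i).1 +
      coeff (Finsupp.single (ι i) e) (k j).1 = 0 := by
    intro i j
    have h := hcoeff (Finsupp.single (ι i) e + Finsupp.single (ι j) e)
    by_cases hij : i = j
    · subst hij
      rw [Finset.sum_eq_single i] at h
      · simp at h
        rw [h, add_zero]
      · intro l _ hl
        have : ι i ≠ ι l := fun h => hl (hι h).symm
        simp [this]; omega
      · simp
    · rw [Finset.sum_eq_add i j hij] at h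
      · have h1 : ι i ≠ ι j := fun h => hij (hι h)
        simpa [h1, h1.symm] using h
      · rintro l _ ⟨hli, hlj⟩
        have h1 : ι i ≠ ι l := fun h => hli (hι h).symm
        have h2 : ι j ≠ ι l := fun h => hlj (hι h).symm
        simp [h1, h2]; omega
      · simp
      · simp
  -- These coefficients are already antisymmetric in i and j, so halving makes a i j - a j i the
  -- coefficient itself.
  refine ⟨fun i j => coeff (Finsupp.single (ι j) e) (k i).1 / 2, fun i => ?_⟩
  refine form_ext_coeff fun μ => ?_
  have hsub : ∀ j, coeff (Finsupp.single (ι j) e) (k i).1 / 2 -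
      coeff (Finsupp.single (ι i) e) (k j).1 / 2 = coeff (Finsupp.single (ι j) e) (k i).1 :=
    fun j => by linear_combination -(hanti i j) / 2
  simp only [hsub, Submodule.coe_sum, Submodule.coe_smul, coeff_sum, coeff_smul, smul_eq_mul]
  by_cases hμ : ∃ l, μ.1 = Finsupp.single (ι l) e
  · obtain ⟨l, hl⟩ := hμ
    simp [hl, coeff_powerTuple ι hι he]
  · push Not at hμ
    rw [Finset.sum_eq_zero fun j _ => by
      rw [powerTuple_coe, coeff_monomial, if_neg fun h => hμ j h.symm, mul_zero]]
    -- As μ is not one of the pure powers, only the i-th generator divides this monomial, so the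
    -- coefficient of μ in `k i` must vanish.
    have h := hcoeff (μ.1 + Finsupp.single (ι i) e)
    rw [Finset.sum_eq_single i] at h
    · simpa using h
    · intro l _ hl
      have h1 : ι i ≠ ι l := fun h => hl (hι h).symm
      rw [if_neg]
      intro hle
      refine hμ l (eq_single_of_le_of_degree μ.2 ?_)
      simpa [h1] using hle
    · simp

/-- The hypothesis `hsoc` moves any degree `e` monomial outside the monomial ideal to one of degree
`2e` still outside it. Hence such monomials cannot occur in `h`; subtracting the trivial solution
leaves relations among pure powers. -/
theorem koszulExact_powerTuple (ι : Fin r → Fin (n + 1)) (hι : ι.Injective) (he : 0 < e)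
    (hsoc : ∀ μ : Exponent n e, (∀ i, μ.1 (ι i) < e) →
      ∃ m : Exponent n e, ∀ i, (μ.1 + m.1) (ι i) < e) :
    KoszulExact (powerTuple e ι) := by
  intro h k hk
  have hspan : h = ∑ i, coeff (Finsupp.single (ι i) e) h.1 • powerTuple e ι i := by
    refine form_ext_coeff fun μ => ?_
    simp only [Submodule.coe_sum, Submodule.coe_smul, coeff_sum, coeff_smul, smul_eq_mul]
    by_cases hμ : ∀ i, μ.1 (ι i) < e
    · obtain ⟨m, hm⟩ := hsoc μ hμ
      have h1 := congrArg (coeff (μ.1 + m.1)) (hk m)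
      rw [coeff_mul_monomial, mul_one, coeff_sum] at h1
      rw [h1, Finset.sum_eq_zero, Finset.sum_eq_zero]
      · intro i _
        rw [powerTuple_coe, coeff_monomial, if_neg, mul_zero]
        intro hi
        have := hμ i
        rw [← hi] at this
        simp at this
      · intro i _
        rw [coeff_mul_powerTuple, if_neg (hm i).not_ge]
    · push Not at hμ
      obtain ⟨l, hl⟩ := hμ
      rw [eq_single_of_le_of_degree μ.2 hl]
      simp [coeff_powerTuple ι hι he]
  have hsyz : ∀ m, ∃ a : Fin r → Fin r → ℂ, ∀ i,
      k m i - coeff (Finsupp.single (ι i) e) h.1 • monomialForm m =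
        ∑ j, (a i j - a j i) • powerTuple e ι j := by
    intro m
    refine exists_antisymm_of_sum_mul_powerTuple_eq_zero ι hι he _ ?_
    simp only [Submodule.coe_sub, sub_mul, Finset.sum_sub_distrib, ← hk m]
    conv_lhs => enter [1, 1]; rw [hspan]
    simp only [Submodule.coe_sum, Submodule.coe_smul, Finset.sum_mul, smul_mul_assoc]
    rw [sub_eq_zero]
    exact Finset.sum_congr rfl fun i _ => by rw [mul_comm]; rfl
  choose a ha using hsyz
  exact ⟨_, a, hspan, fun m i => by rw [← ha m i]; abel⟩

theorem exists_forms_of_forall_monomial (g : Fin r → Form n e)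
    (H : ∀ m : Exponent n (e + e), ∃ k : Fin r → Form n e,
      monomial m.1 1 = ∑ i, (g i).1 * (k i).1) (f : Form n (e + e)) :
    ∃ k : Fin r → Form n e, f.1 = ∑ i, (g i).1 * (k i).1 := by
  choose k hk using H
  refine ⟨fun i => ∑ m, coeff m.1 f.1 • k m i, ?_⟩
  have hf := congrArg Subtype.val ((coordsEquiv n (e + e)).symm_apply_apply f).symm
  change f.1 = (∑ m, coords f m • monomialForm m : Form n (e + e)).1 at hf
  conv_lhs => rw [hf]
  simp only [Submodule.coe_sum, Submodule.coe_smul, Finset.mul_sum, mul_smul_comm]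
  rw [Finset.sum_comm]
  refine Finset.sum_congr rfl fun m _ => ?_
  rw [← Finset.smul_sum, ← hk m]
  rfl

theorem exists_forms_powerTuple (ι : Fin r → Fin (n + 1))
    (hsoc : ∀ m : Exponent n (e + e), ∃ i, e ≤ m.1 (ι i)) (f : Form n (e + e)) :
    ∃ k : Fin r → Form n e, f.1 = ∑ i, (powerTuple e ι i).1 * (k i).1 := by
  refine exists_forms_of_forall_monomial _ (fun m => ?_) f
  obtain ⟨i, hi⟩ := hsoc m
  have hle : Finsupp.single (ι i) e ≤ m.1 := Finsupp.single_le_iff.mpr hi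
  have hdeg : (m.1 - Finsupp.single (ι i) e).degree = e := by
    have := congrArg Finsupp.degree (tsub_add_cancel_of_le hle)
    rw [map_add, Finsupp.degree_single, m.2] at this
    omega
  refine ⟨Pi.single i (monomialForm ⟨_, hdeg⟩), ?_⟩
  rw [Finset.sum_eq_single i (fun j _ hj => by simp [hj]) (by simp), Pi.single_eq_same]
  change _ = monomial _ 1 * monomial _ 1
  rw [monomial_mul, add_tsub_cancel_of_le hle, mul_one]

/-! ### Powers of four linear forms generate degree 2e. -/

section FourForms

theorem homogeneousComponent_mul_of_isHomogeneous {σ R : Type*} [CommSemiring R] {m : ℕ} (n : ℕ)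
    {p : MvPolynomial σ R} (hp : p.IsHomogeneous m) (q : MvPolynomial σ R) :
    homogeneousComponent (m + n) (p * q) = p * homogeneousComponent n q := by
  classical
  conv_lhs => rw [← sum_homogeneousComponent q, Finset.mul_sum, map_sum]
  have h : ∀ j, homogeneousComponent (m + n) (p * homogeneousComponent j q) =
      if n = j then p * homogeneousComponent j q else 0 := fun j => by
    rw [homogeneousComponent_of_mem (n := m + j)
      ((mem_homogeneousSubmodule _ _).mpr (hp.mul (homogeneousComponent_isHomogeneous j q)))]
    simp only [add_right_inj]
  simp only [h, Finset.sum_ite_eq]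
  split_ifs with hn
  · rfl
  · rw [homogeneousComponent_eq_zero, mul_zero]
    simpa using hn

theorem exists_isHomogeneous_of_mem_span {σ R : Type*} [CommRing R] {r m n : ℕ}
    (g : Fin r → MvPolynomial σ R) (hg : ∀ i, (g i).IsHomogeneous m) {f : MvPolynomial σ R}
    (hf : f.IsHomogeneous (m + n)) (h : f ∈ Ideal.span (Set.range g)) :
    ∃ k : Fin r → MvPolynomial σ R, (∀ i, (k i).IsHomogeneous n) ∧ f = ∑ i, g i * k i := by
  obtain ⟨c, hc⟩ := (Ideal.mem_span_range_iff_exists_fun).mp h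
  refine ⟨fun i => homogeneousComponent n (c i),
    fun i => homogeneousComponent_isHomogeneous n _, ?_⟩
  rw [← homogeneousComponent_eq_self hf, ← hc, map_sum]
  refine Finset.sum_congr rfl fun i _ => ?_
  rw [mul_comm, homogeneousComponent_mul_of_isHomogeneous n (hg i)]

variable {k σ : Type*} [Field k]

theorem pderiv_pderiv_comm_of_ne {i j : σ} (hij : i ≠ j) (p : MvPolynomial σ k) :
    pderiv i (pderiv j p) = pderiv j (pderiv i p) := by
  classical
  ext m
  simp only [coeff_pderiv, Finsupp.add_apply, Finsupp.single_eq_of_ne hij,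
    Finsupp.single_eq_of_ne hij.symm, add_zero, add_right_comm]
  ring

/-- Integrate monomial by monomial, once in X_i and once in X_j; the divisors are nonzero in
characteristic zero. -/
theorem exists_pderiv_pderiv_X_pow_mul [CharZero k] {i j : σ} (hij : i ≠ j) (n m : ℕ)
    (u : MvPolynomial σ k) (hu : u.IsHomogeneous n) :
    ∃ v : MvPolynomial σ k, v.IsHomogeneous (n + 1) ∧
      pderiv i (pderiv j (X i ^ (m + 1) * v)) = X i ^ m * u := by
  classical
  refine ⟨∑ s ∈ u.support, monomial (s + Finsupp.single j 1)
    (coeff s u / ((m + 1 + s i) * (s j + 1))), ?_, ?_⟩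
  · refine IsHomogeneous.sum _ _ _ fun s hs => isHomogeneous_monomial _ ?_
    rw [map_add, Finsupp.degree_single]
    congr 1
    by_contra hne
    exact mem_support_iff.mp hs (hu.coeff_eq_zero hne)
  · conv_rhs => rw [u.as_sum]
    simp only [Finset.mul_sum, map_sum]
    refine Finset.sum_congr rfl fun s _ => ?_
    have h1 : (m + 1 + s i : k) ≠ 0 := by exact_mod_cast (by omega : m + 1 + s i ≠ 0)
    have h2 : (s j + 1 : k) ≠ 0 := Nat.cast_add_one_ne_zero _
    rw [X_pow_eq_monomial, X_pow_eq_monomial, monomial_mul, monomial_mul, one_mul, one_mul,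
      pderiv_monomial, pderiv_monomial]
    congr 1
    · congr 1
      ext l
      simp only [Finsupp.tsub_apply, Finsupp.add_apply, Finsupp.single_apply]
      split_ifs <;> omega
    · simp only [Finsupp.tsub_apply, Finsupp.add_apply, Finsupp.single_eq_same,
        Finsupp.single_eq_of_ne hij, Finsupp.single_eq_of_ne hij.symm]
      push_cast
      field_simp
      simp
      ring

/-- The substitution `X i ↦ X i + t * X l`. -/
noncomputable def shear [DecidableEq σ] (i l : σ) (t : k) : MvPolynomial σ k →ₐ[k] MvPolynomial σ k :=
  aeval fun j => X j + if j = i then C t * X l else 0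

theorem shear_X_self [DecidableEq σ] (i l : σ) (t : k) : shear i l t (X i) = X i + C t * X l := by
  simp [shear]

theorem isHomogeneous_shear [DecidableEq σ] (i l : σ) (t : k) {n : ℕ} {p : MvPolynomial σ k}
    (hp : p.IsHomogeneous n) : (shear i l t p).IsHomogeneous n := by
  have := hp.aeval (n := 1) (fun j => X j + if j = i then C t * X l else 0) fun j => by
    refine (isHomogeneous_X k j).add ?_
    split_ifs
    · simpa using (isHomogeneous_C σ t).mul (isHomogeneous_X k l)
    · exact isHomogeneous_zero σ k 1
  simpa [shear] using this

theorem shear_shear_neg [DecidableEq σ] {i l : σ} (hil : i ≠ l) (t : k) (p : MvPolynomial σ k) :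
    shear i l t (shear i l (-t) p) = p := by
  have : (shear i l t).comp (shear i l (-t)) = AlgHom.id k _ := by
    ext1 j
    by_cases hj : j = i
    · subst hj
      simp [shear, hil.symm]
    · simp [shear, hj]
  exact DFunLike.congr_fun this p

theorem pderiv_shear [Fintype σ] [DecidableEq σ] {i j l : σ} (hjl : j ≠ l) (t : k)
    (p : MvPolynomial σ k) : pderiv j (shear i l t p) = shear i l t (pderiv j p) := by
  rw [shear, aeval_pderiv_chain]
  rw [Finset.sum_eq_single j]
  · rw [map_add, pderiv_X_self]
    split_ifs <;> simp [pderiv_X_of_ne hjl.symm]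
  · intro b _ hb
    rw [map_add, pderiv_X_of_ne hb]
    split_ifs <;> simp [pderiv_X_of_ne hjl.symm]
  · simp

/-- The shear carries X_i to the linear form and commutes with both derivatives, which avoid the
direction `l`. -/
theorem exists_pderiv_pderiv_linear_pow_mul [CharZero k] [Fintype σ] {i j l : σ} (hij : i ≠ j)
    (hil : i ≠ l) (hjl : j ≠ l) (t : k) (n m : ℕ) (u : MvPolynomial σ k) (hu : u.IsHomogeneous n) :
    ∃ v : MvPolynomial σ k, v.IsHomogeneous (n + 1) ∧
      pderiv i (pderiv j ((X i + C t * X l) ^ (m + 1) * v)) = (X i + C t * X l) ^ m * u := by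
  classical
  obtain ⟨v, hv, h⟩ := exists_pderiv_pderiv_X_pow_mul hij n m (shear i l (-t) u)
    (isHomogeneous_shear i l (-t) hu)
  refine ⟨shear i l t v, isHomogeneous_shear i l t hv, ?_⟩
  have := congrArg (shear i l t) h
  rwa [← pderiv_shear hil, ← pderiv_shear hjl, map_mul (shear i l t), map_mul (shear i l t),
    map_pow (shear i l t), map_pow (shear i l t), shear_X_self, shear_shear_neg hil] at this

/-- Four linear forms in three variables. -/
noncomputable def fourLinearForms : Fin 4 → MvPolynomial (Fin (2 + 1)) ℂ :=
  ![X 0 + C 1 * X 2, X 0 + C (-1) * X 2, X 1 + C 1 * X 2, X 1 + C (-1) * X 2]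

theorem isHomogeneous_fourLinearForms (i : Fin 4) : (fourLinearForms i).IsHomogeneous 1 := by
  have h : ∀ (j : Fin (2 + 1)) (t : ℂ),
      (X j + C t * X 2 : MvPolynomial (Fin (2 + 1)) ℂ).IsHomogeneous 1 := fun j t => by
    refine (isHomogeneous_X ℂ j).add ?_
    simpa using (isHomogeneous_C _ t).mul (isHomogeneous_X ℂ (2 : Fin (2 + 1)))
  fin_cases i <;> exact h _ _

theorem isHomogeneous_fourLinearForms_pow (e : ℕ) (i : Fin 4) :
    (fourLinearForms i ^ e).IsHomogeneous e := by
  simpa using (isHomogeneous_fourLinearForms i).pow e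

/-- Pigeonhole on exponents: (x, y)^(2e) ⊆ (x^e, y^e). -/
theorem monomial_mem_of_mem_span {R : Type*} [CommRing R] {x y a c : R} (e p q : ℕ)
    (hpq : p + q = e + e) (ha : a ∈ Ideal.span {x, y}) (hc : c ∈ Ideal.span {x, y})
    {J : Ideal R} (hx : x ^ e ∈ J) (hy : y ^ e ∈ J) : a ^ p * c ^ q ∈ J := by
  have h1 : a ^ p * c ^ q ∈ Ideal.span {x, y} ^ (e + e) := by
    rw [← hpq, pow_add]
    exact Ideal.mul_mem_mul (Ideal.pow_mem_pow ha p) (Ideal.pow_mem_pow hc q)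
  rw [Ideal.span_insert] at h1
  have h2 := Ideal.sup_pow_add_le_pow_sup_pow h1
  rw [Ideal.span_singleton_pow, Ideal.span_singleton_pow] at h2
  refine (sup_le ?_ ?_ : _ ≤ J) h2
  · rwa [Ideal.span_singleton_le_iff_mem]
  · rwa [Ideal.span_singleton_le_iff_mem]

/-- The `e`-th powers of four general linear forms generate all ternary forms of degree `2e`. -/
theorem mem_span_fourLinearForms_pow (e : ℕ) (f : MvPolynomial (Fin (2 + 1)) ℂ)
    (hf : f.IsHomogeneous (e + e)) :
    f ∈ Ideal.span (Set.range fun i => fourLinearForms i ^ e) := by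
  induction e generalizing f with
  | zero =>
    have : (1 : MvPolynomial (Fin (2 + 1)) ℂ) ∈
        Ideal.span (Set.range fun i => fourLinearForms i ^ 0) :=
      Ideal.subset_span ⟨0, pow_zero _⟩
    rw [(Ideal.eq_top_iff_one _).mpr this]
    trivial
  | succ e ih =>
    -- Apply ∂₀∂₁, use induction in degree 2e, and integrate back: each l_i^e u_i lifts to l_i^(e+1)
    -- v_i. Only the kernel of ∂₀∂₁ remains.
    have hD : (pderiv 0 (pderiv 1 f)).IsHomogeneous (e + e) := by
      have := (hf.pderiv (i := 1)).pderiv (i := 0)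
      rwa [show e + 1 + (e + 1) - 1 - 1 = e + e by omega] at this
    obtain ⟨u, hu, hDf⟩ := exists_isHomogeneous_of_mem_span _
      (isHomogeneous_fourLinearForms_pow e) hD (ih _ hD)
    have hv : ∀ i, ∃ v : MvPolynomial (Fin (2 + 1)) ℂ, v.IsHomogeneous (e + 1) ∧
        pderiv 0 (pderiv 1 (fourLinearForms i ^ (e + 1) * v)) = fourLinearForms i ^ e * u i := by
      intro i
      have h0 : ∀ (t : ℂ) (u : MvPolynomial (Fin (2 + 1)) ℂ), u.IsHomogeneous e →
          ∃ v : MvPolynomial (Fin (2 + 1)) ℂ, v.IsHomogeneous (e + 1) ∧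
          pderiv 0 (pderiv 1 ((X 0 + C t * X 2) ^ (e + 1) * v)) = (X 0 + C t * X 2) ^ e * u :=
        fun t u hu => exists_pderiv_pderiv_linear_pow_mul (by decide) (by decide) (by decide)
          t e e u hu
      have h1 : ∀ (t : ℂ) (u : MvPolynomial (Fin (2 + 1)) ℂ), u.IsHomogeneous e →
          ∃ v : MvPolynomial (Fin (2 + 1)) ℂ, v.IsHomogeneous (e + 1) ∧
          pderiv 0 (pderiv 1 ((X 1 + C t * X 2) ^ (e + 1) * v)) = (X 1 + C t * X 2) ^ e * u :=
        fun t u hu => by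
          obtain ⟨v, hv, h⟩ := exists_pderiv_pderiv_linear_pow_mul
            (i := (1 : Fin (2 + 1))) (j := 0) (l := 2) (by decide) (by decide) (by decide) t e e u hu
          exact ⟨v, hv, (pderiv_pderiv_comm_of_ne (by decide) _).trans h⟩
      fin_cases i
      · exact h0 _ _ (hu 0)
      · exact h0 _ _ (hu 1)
      · exact h1 _ _ (hu 2)
      · exact h1 _ _ (hu 3)
    choose v hv hDv using hv
    set J := Ideal.span (Set.range fun i => fourLinearForms i ^ (e + 1)) with hJ
    have hgJ : ∀ i, fourLinearForms i ^ (e + 1) ∈ J := fun i => Ideal.subset_span ⟨i, rfl⟩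
    have hsum : ∑ i, fourLinearForms i ^ (e + 1) * v i ∈ J :=
      Ideal.sum_mem _ fun i _ => Ideal.mul_mem_right _ _ (hgJ i)
    set f' := f - ∑ i, fourLinearForms i ^ (e + 1) * v i with hf'
    have hf'hom : f'.IsHomogeneous (e + 1 + (e + 1)) :=
      hf.sub (IsHomogeneous.sum _ _ _ fun i _ =>
        (isHomogeneous_fourLinearForms_pow (e + 1) i).mul (hv i))
    have hDf' : pderiv 0 (pderiv 1 f') = 0 := by
      simp only [hf', map_sub, map_sum, hDv, hDf, sub_self]
    suffices f' ∈ J by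
      have := J.add_mem this hsum
      rwa [hf', sub_add_cancel] at this
    rw [f'.as_sum]
    refine Ideal.sum_mem _ fun s hs => ?_
    have hs0 : coeff s f' ≠ 0 := mem_support_iff.mp hs
    have hdeg : s 0 + s 1 + s 2 = e + 1 + (e + 1) := by
      have : s.degree = e + 1 + (e + 1) := by
        by_contra hne
        exact hs0 (hf'hom.coeff_eq_zero hne)
      rwa [Finsupp.degree_eq_sum, Fin.sum_univ_three] at this
    have hmon : monomial s (coeff s f') = C (coeff s f') * (X 0 ^ s 0 * X 1 ^ s 1 * X 2 ^ s 2) := by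
      rw [monomial_eq, Finsupp.prod_fintype _ _ (by simp), Fin.prod_univ_three]
    -- A form killed by ∂₀∂₁ has only monomials missing x_0 or x_1. Each is then binary, in the
    -- variables spanned by one pair of the linear forms.
    have hzero : s 0 = 0 ∨ s 1 = 0 := by
      by_contra! hne
      have h1 : Finsupp.single 0 1 + Finsupp.single 1 1 ≤ s := by
        intro l
        fin_cases l <;> simp <;> omega
      have h2 := congrArg (coeff (s - (Finsupp.single 0 1 + Finsupp.single 1 1))) hDf'
      rw [coeff_pderiv, coeff_pderiv, add_assoc, tsub_add_cancel_of_le h1, coeff_zero] at h2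
      refine hs0 ((mul_eq_zero.mp ((mul_eq_zero.mp h2).resolve_right
        (Nat.cast_add_one_ne_zero _))).resolve_right (Nat.cast_add_one_ne_zero _))
    have hspan : ∀ (z : MvPolynomial (Fin (2 + 1)) ℂ),
        z ∈ Ideal.span {z + C 1 * X 2, z + C (-1) * X 2} ∧
        X 2 ∈ Ideal.span {z + C 1 * X 2, z + C (-1) * X 2} := by
      intro z
      have hh : (C (1 / 2) : MvPolynomial (Fin (2 + 1)) ℂ) * 2 = 1 := by
        rw [← map_ofNat C 2, ← map_mul]; norm_num
      simp only [Ideal.mem_span_pair]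
      refine ⟨⟨C (1 / 2), C (1 / 2), ?_⟩, ⟨C (1 / 2), -C (1 / 2), ?_⟩⟩
      · rw [map_neg, map_one]
        linear_combination z * hh
      · rw [map_neg, map_one]
        linear_combination X 2 * hh
    rw [hmon]
    refine Ideal.mul_mem_left _ _ ?_
    rcases hzero with h | h
    · rw [h, pow_zero, one_mul]
      exact monomial_mem_of_mem_span (e + 1) _ _ (by omega) (hspan (X 1)).1 (hspan (X 1)).2
        (hgJ 2) (hgJ 3)
    · rw [h, pow_zero, mul_one]
      exact monomial_mem_of_mem_span (e + 1) _ _ (by omega) (hspan (X 0)).1 (hspan (X 0)).2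
        (hgJ 0) (hgJ 1)

end FourForms

/-! ### Bounds on the generic rank and conclusion. -/

theorem exists_forms_fourLinearForms (e : ℕ) : ∃ g : Fin 4 → Form 2 e, ∀ f : Form 2 (e + e),
    ∃ k : Fin 4 → Form 2 e, f.1 = ∑ i, (g i).1 * (k i).1 := by
  refine ⟨fun i => ⟨fourLinearForms i ^ e,
    (mem_homogeneousSubmodule e _).mpr (isHomogeneous_fourLinearForms_pow e i)⟩, fun f => ?_⟩
  obtain ⟨k, hk, hf⟩ := exists_isHomogeneous_of_mem_span _ (isHomogeneous_fourLinearForms_pow e)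
    (isHomogeneous_form f) (mem_span_fourLinearForms_pow e f.1 (isHomogeneous_form f))
  exact ⟨fun i => ⟨k i, (mem_homogeneousSubmodule e _).mpr (hk i)⟩, hf⟩

theorem genericTwoRank_le {n d r : ℕ} (hd : d / 2 + d / 2 = d) (g : Fin r → Form n (d / 2))
    (hg : ∀ f : Form n (d / 2 + d / 2), ∃ k : Fin r → Form n (d / 2),
      f.1 = ∑ i, (g i).1 * (k i).1) : genericTwoRank n d ≤ r := by
  refine Nat.sInf_le (secant_eq_univ_of_surjective hd g fun f => ?_)
  exact hg ⟨f.1, by rw [hd]; exact f.2⟩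

theorem genericallyOIdentifiable_of_koszulExact {n d r : ℕ} (hd : d / 2 + d / 2 = d)
    (g : Fin r → Form n (d / 2)) (hlin : LinearIndependent ℂ g) (hg : KoszulExact g) :
    GenericallyOIdentifiable n d r := by
  obtain ⟨γ, rfl⟩ := (tupleOfCoords n (d / 2) r).surjective g
  obtain ⟨q₁, hq₁, h₁⟩ := exists_forall_linearIndependent γ hlin
  obtain ⟨q₂, hq₂, h₂⟩ := exists_forall_koszulExact γ hg
  refine genericallyOIdentifiable_of_forall hd (q₁ * q₂) (mul_ne_zero hq₁ hq₂) fun γ hγ => ?_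
  rw [map_mul, mul_ne_zero_iff] at hγ
  exact ⟨h₁ γ hγ.1, h₂ γ hγ.2⟩

theorem koszulExact_of_isEmpty {n e : ℕ} (g : Fin 0 → Form n e) : KoszulExact g := by
  intro h k hk
  obtain ⟨m⟩ : Nonempty (Exponent n e) := inferInstance
  have h0 := hk m
  rw [Finset.univ_eq_empty, Finset.sum_empty] at h0
  have h1 : h.1 = 0 :=
    (mul_eq_zero.mp h0).resolve_right (by simp)
  exact ⟨0, 0, Subtype.ext (by simpa using h1), fun _ i => i.elim0⟩

theorem degree_eq_add_three (m : Fin (2 + 1) →₀ ℕ) : m.degree = m 0 + m 1 + m 2 := by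
  rw [Finsupp.degree_eq_sum, Fin.sum_univ_three]

theorem genericTwoRank_two_le_one {d : ℕ} (hd : d / 2 + d / 2 = d) (h : d / 2 = 0) :
    genericTwoRank 2 d ≤ 1 :=
  genericTwoRank_le hd (powerTuple (d / 2) fun _ => 0)
    (exists_forms_powerTuple _ fun m => ⟨0, by omega⟩)

theorem genericTwoRank_two_le_three {d : ℕ} (hd : d / 2 + d / 2 = d) (h : d / 2 ≤ 2) :
    genericTwoRank 2 d ≤ 3 := by
  refine genericTwoRank_le hd (powerTuple (d / 2) id) (exists_forms_powerTuple _ fun m => ?_)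
  have hm := m.2
  rw [degree_eq_add_three] at hm
  by_contra! hlt
  have h0 : m.1 0 < d / 2 := hlt 0
  have h1 : m.1 1 < d / 2 := hlt 1
  have h2 : m.1 2 < d / 2 := hlt 2
  omega

theorem genericTwoRank_two_le_four {d : ℕ} (hd : d / 2 + d / 2 = d) :
    genericTwoRank 2 d ≤ 4 := by
  obtain ⟨g, hg⟩ := exists_forms_fourLinearForms (d / 2)
  exact genericTwoRank_le hd g hg

/-- The powers `x_0 ^ e, …, x_{r-1} ^ e` with `r ≤ 2`, or with `r = 3` and `e ≥ 3`, are Koszul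
exact. -/
theorem koszulExact_powerTuple_castLE {e r : ℕ} (hr : r ≤ 2 + 1) (he : 0 < e)
    (h : r = 3 → 3 ≤ e) : KoszulExact (powerTuple (n := 2) e (Fin.castLE hr)) := by
  refine koszulExact_powerTuple _ (Fin.castLE_injective hr) he fun μ hμ => ?_
  have hdeg := μ.2
  rw [degree_eq_add_three] at hdeg
  by_cases hr3 : r = 3
  · subst hr3
    have h3 := h rfl
    have h0 : μ.1 0 < e := hμ 0
    have h1 : μ.1 1 < e := hμ 1
    have h2 : μ.1 2 < e := hμ 2
    -- The exponents of μ leave total room 3(e - 1) - e = 2e - 3 ≥ e below the bound e - 1; fill it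
    -- greedily.
    obtain ⟨a, b, c, habc, ha, hb, hc⟩ : ∃ a b c : ℕ, a + b + c = e ∧ μ.1 0 + a < e ∧
        μ.1 1 + b < e ∧ μ.1 2 + c < e := by
      by_cases hcase : e ≤ (e - 1 - μ.1 0) + (e - 1 - μ.1 1)
      · exact ⟨e - 1 - μ.1 0, e - (e - 1 - μ.1 0), 0, by omega, by omega, by omega, by omega⟩
      · exact ⟨e - 1 - μ.1 0, e - 1 - μ.1 1, e - (e - 1 - μ.1 0) - (e - 1 - μ.1 1),
          by omega, by omega, by omega, by omega⟩
    refine ⟨⟨Finsupp.equivFunOnFinite.symm ![a, b, c], ?_⟩, fun i => ?_⟩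
    · rw [degree_eq_add_three]
      exact habc
    · fin_cases i
      · exact ha
      · exact hb
      · exact hc
  -- For r ≤ 2 the variable x_2 is not among the generators, so multiplying by x_2^e stays outside
  -- the ideal.
  · refine ⟨⟨Finsupp.single 2 e, by simp⟩, fun i => ?_⟩
    have hi : Fin.castLE hr i ≠ 2 := fun hi => by
      have h1 := congrArg Fin.val hi
      have h2 := i.2
      simp at h1
      omega
    rw [Finsupp.add_apply, Finsupp.single_eq_of_ne hi, add_zero]
    exact hμ i

end SumsOfSquares

theorem mainTheorem4 (d : ℕ) (hd : Even d) (r : ℕ)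
    (hr : r < SumsOfSquares.genericTwoRank 2 d) :
    SumsOfSquares.GenericallyOIdentifiable 2 d r := by
  have hd2 : d / 2 + d / 2 = d := by
    obtain ⟨e, rfl⟩ := hd
    omega
  have h4 := SumsOfSquares.genericTwoRank_two_le_four hd2
  rcases Nat.eq_zero_or_pos r with rfl | hr0
  · exact SumsOfSquares.genericallyOIdentifiable_of_koszulExact hd2 0 linearIndependent_empty_type
      (SumsOfSquares.koszulExact_of_isEmpty _)
  have he : 0 < d / 2 := by
    by_contra! h
    have := SumsOfSquares.genericTwoRank_two_le_one hd2 (by omega)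
    omega
  -- If e ≤ 2, then 2e > 3(e - 1), so the three pure powers generate degree 2e and r_g ≤ 3 excludes
  -- r = 3.
  have h3 : r = 3 → 3 ≤ d / 2 := by
    intro h
    by_contra! h'
    have := SumsOfSquares.genericTwoRank_two_le_three hd2 (by omega)
    omega
  have hr3 : r ≤ 2 + 1 := by omega
  exact SumsOfSquares.genericallyOIdentifiable_of_koszulExact hd2 _
    (SumsOfSquares.linearIndependent_powerTuple _ (Fin.castLE_injective hr3) he)
    (SumsOfSquares.koszulExact_powerTuple_castLE hr3 he h3)
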